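/- All categories are $\mathbb{C}$-linear with finite-dimensional morphism spaces, and all functors are linear. A spherical fusion category is a finitely semisimple rigid monoidal category with simple unit, chosen duals $X^*$ and a pivotal structure (a monoidal natural isomorphism $i\colon 1\to -^{**}$) for which left and right traces agree; $d(X)=\operatorname{tr}(1_X)\in\mathbb{C}$. A ribbon fusion category is a braided fusion category with a twist $\theta$ satisfying the balance equation $\theta_{X\otimes Y}=c_{Y,X}c_{X,Y}(\theta_X\otimes\theta_Y)$ and the ribbon equation $\theta_{X^*}=\theta_X^*$, with its canonical pivotal structure, which is spherical. A pivotal functor is a strong monoidal functor preserving the pivotal structure up to the canonical isomorphisms $F(X^*)\cong (FX)^*$; a ribbon functor is a braided one that preserves the twist. Colours of $\mathcal{C}$ are complex linear combinations of objects; equations between colours are understood in the fusion algebra $\mathbb{C}[\mathcal{C}]$, where isomorphic objects are identified and $X\oplus Y=X+Y$. A functor $F$ acts on colours by $F(\sum\lambda_iX_i)=\sum\lambda_iFX_i$, and $d$ is extended linearly. The Kirby colour is $\Omega_{\mathcal{C}}=\sum_X d(X)\,X$, the sum over representatives of the simple objects. An object $X$ of a braided category is transparent if $c_{Y,X}c_{X,Y}=1_{X\otimes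 Y}$ for all $Y$; the transparent objects form the symmetric centre, and the transparent part $x'$ of a colour $x$ is obtained by expanding $x$ in simple objects and keeping only the transparent ones. Let $L$ be an oriented framed link (given by a blackboard-framed diagram) whose components are partitioned into $h_1$ dotted components (1-handles) and $h_2$ undotted components (2-handles); for example, any special framed link (dotted circle diagram) of a handle decomposition of a smooth closed oriented four-manifold. For colours $x,y$ of a ribbon fusion category, $\langle L(x,y)\rangle\in\mathbb{C}$ is the evaluation of the diagram in the graphical calculus, with dotted components labelled by $x$ and undotted components by $y$, multilinearly in the labels of the components. For a pivotal functor $F\colon\mathcal{C}\to\mathcal{D}$ from a spherical fusion category to a ribbon fusion category whose symmetric centre has trivial twist, the generalised dichromatic invariant is $$I_F(L)=\frac{\langle L(\Omega_{\mathcal{D}},F\Omega_{\mathcal{C}})\rangle}{d(\Omega_{\mathcal{C}})^{h_2-h_1}\,\bigl(d(\Omega_{\mathcal{D}})\,d((F\Omega_{\mathcal{C}})')\bigr)^{h_1}},$$ and for a smooth closed oriented four-manifold $M$ one sets $I_F(M)=I_F(L)$ for any special framed link $L$ of a handle decomposition of $M$. **Proposition.** Let $\mathcal{A}\xrightarrow{F}\mathcal{B}\xrightarrow{G}\mathcal{C}\xrightarrow{H}\mathcal{D}$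 be pivotal functors between spherical fusion categories, where $\mathcal{C}$ and $\mathcal{D}$ are ribbon fusion categories whose symmetric centres have trivial twist ($\theta_X=1_X$ for transparent $X$), and $H$ is a ribbon functor. Assume that for some $n,m\in\mathbb{C}$ $$F\Omega_{\mathcal{A}}=n\,\Omega_{\mathcal{B}},\qquad H\Omega_{\mathcal{C}}=m\,\Omega_{\mathcal{D}},\qquad H\bigl((G\Omega_{\mathcal{B}})'\bigr)=(HG\Omega_{\mathcal{B}})'.$$ Then $I_{HGF}(L)=I_G(L)$ for every framed link $L$ as above. In particular $I_{HGF}(M)=I_G(M)$ for every smooth closed oriented four-manifold $M$, i.e. $I_{HGF}=I_G$. -/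

import Mathlib

open CategoryTheory CategoryTheory.MonoidalCategory CategoryTheory.Limits

noncomputable section

namespace Dichromatic

universe v u v' u'

/-! ## Duals

Convention: the chosen dual `X*` of `X` comes with `ev : X ⊗ X* ⟶ I` and `coev : I ⟶ X* ⊗ X`.
In Mathlib's terminology this is a choice of left duals, `LeftRigidCategory`. -/

section Duals

variable {C : Type u} [Category.{v} C] [MonoidalCategory C] [LeftRigidCategory C]

/-- The chosen dual `X*`. -/
def dual (X : C) : C := (LeftRigidCategory.leftDual X).leftDual

/-- The evaluation `X ⊗ X* ⟶ I`. -/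
def ev (X : C) : X ⊗ dual X ⟶ 𝟙_ C :=
  (LeftRigidCategory.leftDual X).exact.evaluation

/-- The coevaluation `I ⟶ X* ⊗ X`. -/
def coev (X : C) : 𝟙_ C ⟶ dual X ⊗ X :=
  (LeftRigidCategory.leftDual X).exact.coevaluation

/-- The morphism `Y ⟶ X*` that corresponds to a pairing `e : X ⊗ Y ⟶ I`, i.e. the unique `g` with
`(1 ⊗ g) ≫ ev X = e`. -/
def toDual {X Y : C} (e : X ⊗ Y ⟶ 𝟙_ C) : Y ⟶ dual X :=
  (λ_ Y).inv ≫ coev X ▷ Y ≫ (α_ (dual X) X Y).hom ≫ dual X ◁ e ≫ (ρ_ (dual X)).hom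

/-- The dual `f* : Y* ⟶ X*` of a morphism `f : X ⟶ Y`. -/
def dualMap {X Y : C} (f : X ⟶ Y) : dual Y ⟶ dual X :=
  toDual (f ▷ dual Y ≫ ev Y)

/-- The canonical isomorphism `Y* ⊗ X* ⟶ (X ⊗ Y)*`. -/
def dualTensor (X Y : C) : dual Y ⊗ dual X ⟶ dual (X ⊗ Y) :=
  toDual ((α_ X Y (dual Y ⊗ dual X)).hom ≫ X ◁ (α_ Y (dual Y) (dual X)).inv ≫
    X ◁ (ev Y ▷ dual X) ≫ X ◁ (λ_ (dual X)).hom ≫ ev X)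

variable (C) in
/-- The canonical isomorphism `I ⟶ I*`. -/
def dualUnit : 𝟙_ C ⟶ dual (𝟙_ C) :=
  toDual (λ_ (𝟙_ C)).hom

end Duals

/-! ## Pivotal, fusion, spherical and ribbon categories -/

/-- A pivotal category: chosen duals together with a monoidal natural isomorphism `i : 1 ⟶ **`. The
two monoidality axioms compare `i` with the canonical monoidal structure of the double dual: they
are written after composition with the isomorphisms `(X ⊗ Y)** ⟶ (Y* ⊗ X*)*` and `I** ⟶ I*`. -/
class PivotalCategory (C : Type u) [Category.{v} C] [MonoidalCategory C] extends
    LeftRigidCategory C where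
  piv : ∀ X : C, X ≅ dual (dual X)
  piv_natural : ∀ {X Y : C} (f : X ⟶ Y),
    f ≫ (piv Y).hom = (piv X).hom ≫ dualMap (dualMap f)
  piv_tensor : ∀ X Y : C,
    (piv (X ⊗ Y)).hom ≫ dualMap (dualTensor X Y) =
      ((piv X).hom ⊗ₘ (piv Y).hom) ≫ dualTensor (dual Y) (dual X)
  piv_unit : (piv (𝟙_ C)).hom ≫ dualMap (dualUnit C) = dualUnit C

section Pivotal

variable {C : Type u} [Category.{v} C] [MonoidalCategory C] [PivotalCategory C]

open PivotalCategory

/-- The second evaluation `X* ⊗ X ⟶ I` of a pivotal category. -/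
def evTilde (X : C) : dual X ⊗ X ⟶ 𝟙_ C :=
  dual X ◁ (piv X).hom ≫ ev (dual X)

/-- The second coevaluation `I ⟶ X ⊗ X*` of a pivotal category. -/
def coevTilde (X : C) : 𝟙_ C ⟶ X ⊗ dual X :=
  coev (dual X) ≫ (piv X).inv ▷ dual X

/-- The right trace. -/
def trR {X : C} (f : X ⟶ X) : 𝟙_ C ⟶ 𝟙_ C :=
  coevTilde X ≫ f ▷ dual X ≫ ev X

/-- The left trace. -/
def trL {X : C} (f : X ⟶ X) : 𝟙_ C ⟶ 𝟙_ C :=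
  coev X ≫ dual X ◁ f ≫ evTilde X

end Pivotal

/-- `X` is simple: its endomorphism algebra is `ℂ`, i.e. it consists of the multiples of `1`, which
is not zero. -/
def IsSimple {C : Type u} [Category.{v} C] [Preadditive C] [Linear ℂ C] (X : C) : Prop :=
  Function.Bijective (fun c : ℂ => c • 𝟙 X)

/-- The map `⨁_Z C(X, Z) ⊗ C(Z, Y) ⟶ C(X, Y)` given by composition and addition, for a finite family
of objects `Z`. -/
def compositionMap {C : Type u} [Category.{v} C] [Preadditive C] [Linear ℂ C]
    {ι : Type} [Fintype ι] (Z : ι → C) (X Y : C) :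
    (∀ i, TensorProduct ℂ (X ⟶ Z i) (Z i ⟶ Y)) →ₗ[ℂ] (X ⟶ Y) :=
  ∑ i, TensorProduct.lift (Linear.comp X (Z i) Y) ∘ₗ LinearMap.proj i

/-- The part of the definition of a fusion category that does not concern duals: a `ℂ`-linear
monoidal category with finite-dimensional morphism spaces and bilinear tensor product that is
finitely semisimple (biproducts, split idempotents, a finite set `irr` of inequivalent simple
objects through which all morphisms decompose uniquely) and has a simple unit. -/
class FusionCategory (C : Type u) [Category.{v} C] [Preadditive C] [Linear ℂ C]
    [MonoidalCategory C] extends MonoidalPreadditive C, MonoidalLinear ℂ C,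
    HasFiniteBiproducts C, IsIdempotentComplete C where
  finiteDimensional_hom : ∀ X Y : C, FiniteDimensional ℂ (X ⟶ Y)
  numIrr : ℕ
  irr : Fin numIrr → C
  irr_simple : ∀ i, IsSimple (irr i)
  irr_inequivalent : ∀ i j, i ≠ j → IsEmpty (irr i ≅ irr j)
  irr_decompose : ∀ X Y : C, Function.Bijective (compositionMap irr X Y)
  unit_simple : IsSimple (𝟙_ C)

/-- A spherical fusion category. -/
class SphericalFusionCategory (C : Type u) [Category.{v} C] [Preadditive C] [Linear ℂ C]
    [MonoidalCategory C] extends PivotalCategory C, FusionCategory C where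
  spherical : ∀ {X : C} (f : X ⟶ X), trL f = trR f

/-- A ribbon fusion category, with its canonical pivotal structure: a braiding and a twist that
satisfy the balance equation and the ribbon equation, where `twist_eq_curl` says that the pivotal
structure is the one that corresponds to the twist (the twist is the positive curl). -/
class RibbonFusionCategory (C : Type u) [Category.{v} C] [Preadditive C] [Linear ℂ C]
    [MonoidalCategory C] extends SphericalFusionCategory C, BraidedCategory C where
  twist : ∀ X : C, X ≅ X
  twist_natural : ∀ {X Y : C} (f : X ⟶ Y), f ≫ (twist Y).hom = (twist X).hom ≫ f
  balance : ∀ X Y : C, (twist (X ⊗ Y)).hom =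
    ((twist X).hom ⊗ₘ (twist Y).hom) ≫ (β_ X Y).hom ≫ (β_ Y X).hom
  ribbon : ∀ X : C, (twist (dual X)).hom = dualMap (twist X).hom
  twist_eq_curl : ∀ X : C, (twist X).hom =
    (ρ_ X).inv ≫ X ◁ coev (dual X) ≫ (α_ X (dual (dual X)) (dual X)).inv ≫
      (β_ X (dual (dual X))).hom ▷ dual X ≫ (α_ (dual (dual X)) X (dual X)).hom ≫
      dual (dual X) ◁ ev X ≫ (ρ_ (dual (dual X))).hom ≫ (piv X).inv

/-! ## Functors -/

section Functors

variable {C : Type u} [Category.{v} C] [MonoidalCategory C]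
  {D : Type u'} [Category.{v'} D] [MonoidalCategory D]

/-- The canonical isomorphism `u : F(X*) ⟶ (F X)*` of a strong monoidal functor. -/
def dualComparison [LeftRigidCategory C] [LeftRigidCategory D] (F : C ⥤ D) [F.Monoidal] (X : C) :
    F.obj (dual X) ⟶ dual (F.obj X) :=
  toDual (Functor.LaxMonoidal.μ F X (dual X) ≫ F.map (ev X) ≫ Functor.OplaxMonoidal.η F)

/-- A strong monoidal functor is pivotal if it preserves the pivotal structure up to the canonical
isomorphisms. -/
def IsPivotal [PivotalCategory C] [PivotalCategory D] (F : C ⥤ D) [F.Monoidal] : Prop :=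
  ∀ X : C, (PivotalCategory.piv (F.obj X)).hom ≫ dualMap (dualComparison F X) =
    F.map (PivotalCategory.piv X).hom ≫ dualComparison F (dual X)

end Functors

/-- A functor between ribbon categories preserves the twist. A braided functor with this property is
a ribbon functor. -/
def PreservesTwist {C : Type u} [Category.{v} C] [Preadditive C] [Linear ℂ C] [MonoidalCategory C]
    [RibbonFusionCategory C] {D : Type u'} [Category.{v'} D] [Preadditive D] [Linear ℂ D]
    [MonoidalCategory D] [RibbonFusionCategory D] (F : C ⥤ D) : Prop :=
  ∀ X : C, F.map (RibbonFusionCategory.twist X).hom = (RibbonFusionCategory.twist (F.obj X)).hom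

/-! ## Colours -/

section Colours

/-- Formal complex linear combinations of objects. -/
abbrev Colour (C : Type u) : Type u := C →₀ ℂ

/-- The linear relations of the fusion algebra: isomorphic objects are identified, and a biproduct
is the sum of its summands. -/
def fusionRelations (C : Type u) [Category.{v} C] [Preadditive C] : Submodule ℂ (Colour C) :=
  Submodule.span ℂ
    ({x | ∃ X Y : C, Nonempty (X ≅ Y) ∧ x = Finsupp.single X 1 - Finsupp.single Y 1} ∪
      {x | ∃ (X Y : C) (b : BinaryBicone X Y), Nonempty b.IsBilimit ∧
        x = Finsupp.single b.pt 1 - Finsupp.single X 1 - Finsupp.single Y 1})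

/-- The fusion algebra `ℂ[C]`, as a complex vector space. (Because of the relation `X Y = X ⊗ Y` in
the algebra, it is spanned by the objects, with the relations above; its product, which is induced
by the tensor product, is not needed.) -/
abbrev FusionAlgebra (C : Type u) [Category.{v} C] [Preadditive C] : Type u :=
  Colour C ⧸ fusionRelations C

/-- The element of the fusion algebra that a formal linear combination of objects represents. -/
def toFusionAlgebra {C : Type u} [Category.{v} C] [Preadditive C] :
    Colour C →ₗ[ℂ] FusionAlgebra C :=
  (fusionRelations C).mkQ

/-- The image `F X = ∑ λᵢ F Xᵢ` of a colour `X = ∑ λᵢ Xᵢ` under a functor. -/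
def mapColour {C : Type u} [Category.{v} C] {D : Type u'} [Category.{v'} D] (F : C ⥤ D) :
    Colour C →ₗ[ℂ] Colour D :=
  Finsupp.lmapDomain ℂ ℂ F.obj

variable {C : Type u} [Category.{v} C] [Preadditive C] [Linear ℂ C] [MonoidalCategory C]

/-- The complex number that corresponds to an endomorphism of the unit. -/
def scalar [FusionCategory C] (f : 𝟙_ C ⟶ 𝟙_ C) : ℂ :=
  (Equiv.ofBijective _ (FusionCategory.unit_simple (C := C))).symm f

/-- The dimension `d(X) = tr(1_X)`. -/
def dim [SphericalFusionCategory C] (X : C) : ℂ :=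
  scalar (trR (𝟙 X))

/-- The dimension of a colour. -/
def colourDim [SphericalFusionCategory C] (x : Colour C) : ℂ :=
  x.sum fun X c => c * dim X

variable (C) in
/-- The Kirby colour `Ω = ∑ d(X) X`, where `X` ranges over the simple objects. -/
def kirbyColour [SphericalFusionCategory C] : Colour C :=
  ∑ i, Finsupp.single (FusionCategory.irr (C := C) i) (dim (FusionCategory.irr (C := C) i))

/-- `X` is transparent. -/
def IsTransparent [BraidedCategory C] (X : C) : Prop :=
  ∀ Y : C, (β_ X Y).hom ≫ (β_ Y X).hom = 𝟙 (X ⊗ Y)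

variable (C) in
/-- The symmetric centre has trivial twist. -/
def TrivialTwistOnCentre [RibbonFusionCategory C] : Prop :=
  ∀ X : C, IsTransparent X → (RibbonFusionCategory.twist X).hom = 𝟙 X

open Classical in
/-- The transparent part of an object: decompose it into simple objects, where `irr i` has
multiplicity `dim C(irr i, X)`, and keep the transparent ones. -/
def objTransparentPart [RibbonFusionCategory C] (X : C) : Colour C :=
  ∑ i, if IsTransparent (FusionCategory.irr (C := C) i) then
    Finsupp.single (FusionCategory.irr (C := C) i)
      (Module.finrank ℂ (FusionCategory.irr (C := C) i ⟶ X) : ℂ) else 0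

/-- The transparent part `X'` of a colour `X`. -/
def transparentPart [RibbonFusionCategory C] (x : Colour C) : Colour C :=
  x.sum fun X c => c • objTransparentPart X

end Colours

/-! ## Framed link diagrams

A diagram is cut into horizontal slices, each of which contains one minimum, maximum or crossing. The
strands at a given height form a list, from left to right; a strand `(k, b)` belongs to the link
component `k` and points upwards if `b = true`, downwards if `b = false`. The framing is the
blackboard framing. -/

/-- A slice of a diagram, read from the bottom to the top. The minimum, maximum or crossing is at the
left end of the slice; `wire` adds a vertical strand to the left of a slice. -/
inductive Slice (κ : Type) : List (κ × Bool) → List (κ × Bool) → Type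
  | cup (k : κ) (b : Bool) (w : List (κ × Bool)) : Slice κ w ((k, b) :: (k, !b) :: w)
  | cap (k : κ) (b : Bool) (w : List (κ × Bool)) : Slice κ ((k, b) :: (k, !b) :: w) w
  /-- If `o = true`, the strand from the lower left to the upper right is the upper one. -/
  | cross (x y : κ × Bool) (o : Bool) (w : List (κ × Bool)) : Slice κ (x :: y :: w) (y :: x :: w)
  | wire (x : κ × Bool) {w w' : List (κ × Bool)} (s : Slice κ w w') : Slice κ (x :: w) (x :: w')

/-- A tangle diagram: a stack of slices. -/
inductive Diagram (κ : Type) : List (κ × Bool) → List (κ × Bool) → Type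
  | nil (w : List (κ × Bool)) : Diagram κ w w
  | cons {w w' w'' : List (κ × Bool)} (s : Slice κ w w') (d : Diagram κ w' w'') : Diagram κ w w''

/-- Which points on the boundary of a slice are joined by an arc in it: `Sum.inl p` is the `p`-th
point at the bottom, `Sum.inr p` the `p`-th point at the top. -/
inductive Slice.Joins {κ : Type} :
    {w w' : List (κ × Bool)} → Slice κ w w' → ℕ ⊕ ℕ → ℕ ⊕ ℕ → Prop
  | cup_turn (k : κ) (b : Bool) (w : List (κ × Bool)) :
      Joins (Slice.cup k b w) (Sum.inr 0) (Sum.inr 1)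
  | cup_rest (k : κ) (b : Bool) (w : List (κ × Bool)) (p : ℕ) :
      Joins (Slice.cup k b w) (Sum.inl p) (Sum.inr (p + 2))
  | cap_turn (k : κ) (b : Bool) (w : List (κ × Bool)) :
      Joins (Slice.cap k b w) (Sum.inl 0) (Sum.inl 1)
  | cap_rest (k : κ) (b : Bool) (w : List (κ × Bool)) (p : ℕ) :
      Joins (Slice.cap k b w) (Sum.inl (p + 2)) (Sum.inr p)
  | cross_right (x y : κ × Bool) (o : Bool) (w : List (κ × Bool)) :
      Joins (Slice.cross x y o w) (Sum.inl 0) (Sum.inr 1)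
  | cross_left (x y : κ × Bool) (o : Bool) (w : List (κ × Bool)) :
      Joins (Slice.cross x y o w) (Sum.inl 1) (Sum.inr 0)
  | cross_rest (x y : κ × Bool) (o : Bool) (w : List (κ × Bool)) (p : ℕ) :
      Joins (Slice.cross x y o w) (Sum.inl (p + 2)) (Sum.inr (p + 2))
  | wire_first (x : κ × Bool) {w w' : List (κ × Bool)} (s : Slice κ w w') :
      Joins (Slice.wire x s) (Sum.inl 0) (Sum.inr 0)
  | wire_rest (x : κ × Bool) {w w' : List (κ × Bool)} (s : Slice κ w w') {P Q : ℕ ⊕ ℕ}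
      (h : Joins s P Q) :
      Joins (Slice.wire x s) (P.map Nat.succ Nat.succ) (Q.map Nat.succ Nat.succ)

namespace Diagram

variable {κ : Type}

/-- The strands at height `j`, i.e. below the `j`-th slice. -/
def strandsAt : {w w' : List (κ × Bool)} → Diagram κ w w' → ℕ → List (κ × Bool)
  | _, _, .nil w, 0 => w
  | _, _, .nil _, _ + 1 => []
  | w, _, .cons _ _, 0 => w
  | _, _, .cons _ d, j + 1 => d.strandsAt j

/-- The `P.2`-th strand at height `P.1` exists and belongs to the component `k`. -/
def OnComponent {w w' : List (κ × Bool)} (d : Diagram κ w w') (k : κ) (P : ℕ × ℕ) : Prop :=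
  ∃ b : Bool, (d.strandsAt P.1)[P.2]? = some (k, b)

/-- A boundary point of the lowest slice as a point (height, position) of the diagram. -/
def bottomPoint : ℕ ⊕ ℕ → ℕ × ℕ
  | .inl p => (0, p)
  | .inr p => (1, p)

/-- Which points (height, position) of the diagram are joined by an arc in one of its slices. -/
inductive Joins : {w w' : List (κ × Bool)} → Diagram κ w w' → ℕ × ℕ → ℕ × ℕ → Prop
  | here {w w' w'' : List (κ × Bool)} (s : Slice κ w w') (d : Diagram κ w' w'') {P Q : ℕ ⊕ ℕ}
      (h : s.Joins P Q) : Joins (.cons s d) (bottomPoint P) (bottomPoint Q)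
  | there {w w' w'' : List (κ × Bool)} (s : Slice κ w w') (d : Diagram κ w' w'') {P Q : ℕ × ℕ}
      (h : Joins d P Q) : Joins (.cons s d) (P.1 + 1, P.2) (Q.1 + 1, Q.2)

end Diagram

/-- A diagram of an oriented framed link whose components are indexed by `κ`: a closed diagram in
which the strands with a given index `k` form exactly one closed curve. -/
structure LinkDiagram (κ : Type) where
  diagram : Diagram κ [] []
  component_nonempty : ∀ k, ∃ P, diagram.OnComponent k P
  component_connected : ∀ k P Q, diagram.OnComponent k P → diagram.OnComponent k Q →
    Relation.EqvGen diagram.Joins P Q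

/-- A diagram of a framed link whose components are partitioned into `h₁` dotted components (the
1-handles) and `h₂` undotted components (the 2-handles). -/
structure DottedLinkDiagram where
  h₁ : ℕ
  h₂ : ℕ
  link : LinkDiagram (Fin h₁ ⊕ Fin h₂)

/-! ## Evaluation of link diagrams -/

section Evaluation

variable {C : Type u} [Category.{v} C] [MonoidalCategory C]

/-- An upward strand carries `X`, a downward strand `X*`. -/
def signed [LeftRigidCategory C] (X : C) : Bool → C
  | true => X
  | false => dual X

/-- The tensor product of the strands in a list. -/
def strandsObj [LeftRigidCategory C] {κ : Type} (V : κ → C) : List (κ × Bool) → C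
  | [] => 𝟙_ C
  | x :: w => signed (V x.1) x.2 ⊗ strandsObj V w

/-- The morphism of a minimum. -/
def cupMap [PivotalCategory C] (X : C) : (b : Bool) → (𝟙_ C ⟶ signed X b ⊗ signed X (!b))
  | true => coevTilde X
  | false => coev X

/-- The morphism of a maximum. -/
def capMap [PivotalCategory C] (X : C) : (b : Bool) → (signed X b ⊗ signed X (!b) ⟶ 𝟙_ C)
  | true => ev X
  | false => evTilde X

/-- The morphism of a crossing. -/
def crossMap [BraidedCategory C] (X Y : C) : Bool → (X ⊗ Y ⟶ Y ⊗ X)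
  | true => (β_ X Y).hom
  | false => (β_ Y X).inv

/-- The morphism of a slice whose components are labelled by the objects `V k`. -/
def Slice.eval [PivotalCategory C] [BraidedCategory C] {κ : Type} (V : κ → C) :
    {w w' : List (κ × Bool)} → Slice κ w w' → (strandsObj V w ⟶ strandsObj V w')
  | _, _, .cup k b w =>
      (λ_ (strandsObj V w)).inv ≫ cupMap (V k) b ▷ strandsObj V w ≫ (α_ _ _ _).hom
  | _, _, .cap k b w =>
      (α_ (signed (V k) b) (signed (V k) (!b)) (strandsObj V w)).inv ≫
        capMap (V k) b ▷ strandsObj V w ≫ (λ_ (strandsObj V w)).hom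
  | _, _, .cross x y o w =>
      (α_ (signed (V x.1) x.2) (signed (V y.1) y.2) (strandsObj V w)).inv ≫
        crossMap (signed (V x.1) x.2) (signed (V y.1) y.2) o ▷ strandsObj V w ≫ (α_ _ _ _).hom
  | _, _, .wire x s => signed (V x.1) x.2 ◁ s.eval V

/-- The morphism of a tangle diagram whose components are labelled by the objects `V k`. -/
def Diagram.eval [PivotalCategory C] [BraidedCategory C] {κ : Type} (V : κ → C) :
    {w w' : List (κ × Bool)} → Diagram κ w w' → (strandsObj V w ⟶ strandsObj V w')
  | _, _, .nil w => 𝟙 (strandsObj V w)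
  | _, _, .cons s d => s.eval V ≫ d.eval V

variable [Preadditive C] [Linear ℂ C] [RibbonFusionCategory C]

/-- The evaluation of a link diagram whose components are labelled by the objects `V k`. -/
def LinkDiagram.eval {κ : Type} (L : LinkDiagram κ) (V : κ → C) : ℂ :=
  scalar (L.diagram.eval V)

/-- The evaluation `⟨L(x, y)⟩`, with the dotted components labelled by the colour `x` and the others
by the colour `y`; it is multilinear in the labels of the components. -/
def DottedLinkDiagram.eval (L : DottedLinkDiagram) (x y : Colour C) : ℂ :=
  ∑ f ∈ Fintype.piFinset (fun _ : Fin L.h₁ => x.support),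
    ∑ g ∈ Fintype.piFinset (fun _ : Fin L.h₂ => y.support),
      (∏ i, x (f i)) * (∏ j, y (g j)) * L.link.eval (Sum.elim f g)

end Evaluation

/-- The generalised dichromatic invariant
`I_F(L) = ⟨L(Ω_D, F Ω_C)⟩ / (d(Ω_C) ^ (h₂ - h₁) * (d(Ω_D) * d((F Ω_C)')) ^ h₁)`. It does not depend on
the monoidal coherence of `F`. -/
def dichromaticInvariant {C : Type u} [Category.{v} C] [Preadditive C] [Linear ℂ C]
    [MonoidalCategory C] [SphericalFusionCategory C]
    {D : Type u'} [Category.{v'} D] [Preadditive D] [Linear ℂ D]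
    [MonoidalCategory D] [RibbonFusionCategory D] (F : C ⥤ D) (L : DottedLinkDiagram) : ℂ :=
  L.eval (kirbyColour D) (mapColour F (kirbyColour C)) /
    (colourDim (kirbyColour C) ^ ((L.h₂ : ℤ) - (L.h₁ : ℤ)) *
      (colourDim (kirbyColour D) *
        colourDim (transparentPart (mapColour F (kirbyColour C)))) ^ L.h₁)

end Dichromatic

end

open Dichromatic

universe v₁ v₂ v₃ v₄ u₁ u₂ u₃ u₄

/-! Write $d$ for the dimension and a prime for the transparent part. Evaluation of link diagrams,
$d$ and the transparent part all descend to the fusion algebra, so the three hypotheses may be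
substituted freely. With $\Omega_D=m^{-1}H\Omega_C$ and $HGF\Omega_A=n\,HG\Omega_B$, multilinearity
makes the numerator $m^{-h_1}n^{h_2}\langle L(H\Omega_C,HG\Omega_B)\rangle$, and a braided pivotal
functor preserves evaluations, so $H$ may be removed. In the denominator,
$d(\Omega_A)=n\,d(\Omega_B)$, $d(\Omega_D)=m^{-1}d(\Omega_C)$ and
$d((HGF\Omega_A)')=n\,d((G\Omega_B)')$ together produce the same factor $m^{-h_1}n^{h_2}$. The
factors cancel once $n,m\neq0$.

Three facts carry this. First, evaluation is additive in the label of a component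
(`LinkDiagram.eval_update_biprod`). A summand of a label is a retract; evaluating with the summand
amounts to inserting its idempotent everywhere on the component. Since the component is connected
and idempotents slide along arcs, one insertion suffices, and a single insertion is linear in the
endomorphism.

Second, pivotal functors respect both kinds of cups and caps up to the comparison $F(X^*)\to(FX)^*$,
so `Slice.map_eval` can be proved slice by slice. The same compatibility gives preservation of
dimensions.

Third, the global dimension is nonzero (`colourDim_kirbyColour_ne_zero`). Tensoring with $X^*$ has
the transposed multiplicity matrix of tensoring with $X$, the vector of simple dimensions is an
eigenvector of both, and sphericality makes the eigenvalues $d(X^*)$ and $d(X)$ equal. Hence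
dimensions are real and the global dimension is a sum of squares of real numbers, not all zero.
Applying $d$ to the first two hypotheses then excludes $n=0$ and $m=0$. -/

namespace Dichromatic

open PivotalCategory

/-! ### Calculus of chosen duals -/

section Duals

variable {C : Type u₁} [Category.{v₁} C] [MonoidalCategory C] [LeftRigidCategory C]

/-- The exact pairing of an object with its chosen dual. -/
instance dualPairing (X : C) : ExactPairing (dual X) X := (LeftRigidCategory.leftDual X).exact

lemma ev_eq (X : C) : ev X = ExactPairing.evaluation (dual X) X := rfl

lemma zigzag_left (X : C) : X ◁ coev X ⊗≫ ev X ▷ X = ⊗𝟙.hom :=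
  ExactPairing.coevaluation_evaluation'' (dual X) X

lemma zigzag_right (X : C) : coev X ▷ dual X ⊗≫ dual X ◁ ev X = ⊗𝟙.hom :=
  ExactPairing.evaluation_coevaluation'' (dual X) X

lemma whiskerLeft_toDual_ev {X Y : C} (e : X ⊗ Y ⟶ 𝟙_ C) : X ◁ toDual e ≫ ev X = e := by
  calc
    _ = 𝟙 _ ⊗≫ X ◁ coev X ▷ Y ⊗≫ ((X ⊗ dual X) ◁ e ≫ ev X ▷ 𝟙_ C) ⊗≫ 𝟙 _ := by
      rw [toDual]; monoidal
    _ = 𝟙 _ ⊗≫ (X ◁ coev X ⊗≫ ev X ▷ X) ▷ Y ⊗≫ e := by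
      rw [whisker_exchange]; monoidal
    _ = e := by
      rw [zigzag_left]; monoidal

lemma toDual_whiskerLeft_ev {X Y : C} (g : Y ⟶ dual X) : toDual (X ◁ g ≫ ev X) = g := by
  calc
    _ = 𝟙 _ ⊗≫ (coev X ▷ Y ≫ (dual X ⊗ X) ◁ g) ⊗≫ dual X ◁ ev X ⊗≫ 𝟙 _ := by
      rw [toDual]; monoidal
    _ = g ⊗≫ (coev X ▷ dual X ⊗≫ dual X ◁ ev X) ⊗≫ 𝟙 _ := by
      rw [← whisker_exchange]; monoidal
    _ = g := by
      rw [zigzag_right]; monoidal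

/-- Morphisms into a dual correspond to pairings. This is the test by which the identities between
such morphisms below are reduced to evaluations. -/
lemma dual_hom_ext {X Y : C} {g h : Y ⟶ dual X} (w : X ◁ g ≫ ev X = X ◁ h ≫ ev X) : g = h := by
  rw [← toDual_whiskerLeft_ev g, w, toDual_whiskerLeft_ev]

lemma whiskerLeft_dualMap_ev {X Y : C} (f : X ⟶ Y) :
    X ◁ dualMap f ≫ ev X = f ▷ dual Y ≫ ev Y :=
  whiskerLeft_toDual_ev _

/-- The comparison of an exact pairing with the chosen dual respects coevaluations. -/
lemma coevaluation_toDual (X Y : C) [ExactPairing Y X] :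
    ExactPairing.coevaluation Y X ≫ toDual (ExactPairing.evaluation Y X) ▷ X = coev X := by
  calc
    _ = 𝟙 _ ⊗≫ (𝟙_ C ◁ ExactPairing.coevaluation Y X ≫ coev X ▷ (Y ⊗ X)) ⊗≫
          dual X ◁ (ExactPairing.evaluation Y X ▷ X) ⊗≫ 𝟙 _ := by
      rw [toDual]; monoidal
    _ = coev X ⊗≫ dual X ◁ (X ◁ ExactPairing.coevaluation Y X ⊗≫
          ExactPairing.evaluation Y X ▷ X) ⊗≫ 𝟙 _ := by
      rw [whisker_exchange]; monoidal
    _ = _ := by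
      rw [ExactPairing.coevaluation_evaluation'']; monoidal

/-- The comparison of an exact pairing with the chosen dual is an isomorphism. -/
lemma isIso_toDual_evaluation (X Y : C) [ExactPairing Y X] :
    IsIso (toDual (ExactPairing.evaluation Y X)) := by
  let k : dual X ⟶ Y := 𝟙 _ ⊗≫ ExactPairing.coevaluation Y X ▷ dual X ⊗≫ Y ◁ ev X ⊗≫ 𝟙 _
  have hk : X ◁ k ≫ ExactPairing.evaluation Y X = ev X := by
    calc
      _ = 𝟙 _ ⊗≫ X ◁ ExactPairing.coevaluation Y X ▷ dual X ⊗≫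
          ((X ⊗ Y) ◁ ev X ≫ ExactPairing.evaluation Y X ▷ 𝟙_ C) ⊗≫ 𝟙 _ := by
        simp only [k]; monoidal
      _ = 𝟙 _ ⊗≫ (X ◁ ExactPairing.coevaluation Y X ⊗≫
          ExactPairing.evaluation Y X ▷ X) ▷ dual X ⊗≫ ev X := by
        rw [whisker_exchange]; monoidal
      _ = _ := by
        rw [ExactPairing.coevaluation_evaluation'']; monoidal
  have h1 : k ≫ toDual (ExactPairing.evaluation Y X) = 𝟙 _ := by
    apply dual_hom_ext
    rw [MonoidalCategory.whiskerLeft_comp, Category.assoc, whiskerLeft_toDual_ev, hk]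
    simp
  have h2 : toDual (ExactPairing.evaluation Y X) ≫ k = 𝟙 _ := by
    calc
      _ = 𝟙 _ ⊗≫ (𝟙_ C ◁ toDual (ExactPairing.evaluation Y X) ≫
            ExactPairing.coevaluation Y X ▷ dual X) ⊗≫ Y ◁ ev X ⊗≫ 𝟙 _ := by
        simp only [k]; monoidal
      _ = 𝟙 _ ⊗≫ ExactPairing.coevaluation Y X ▷ Y ⊗≫
            Y ◁ (X ◁ toDual (ExactPairing.evaluation Y X) ≫ ev X) ⊗≫ 𝟙 _ := by
        rw [whisker_exchange]; monoidal
      _ = 𝟙 _ ⊗≫ (ExactPairing.coevaluation Y X ▷ Y ⊗≫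
            Y ◁ ExactPairing.evaluation Y X) ⊗≫ 𝟙 _ := by
        rw [whiskerLeft_toDual_ev]; monoidal
      _ = _ := by
        rw [ExactPairing.evaluation_coevaluation'']; monoidal
  exact ⟨k, h2, h1⟩

/-- A morphism slides through a minimum: expanding the dual map creates a zigzag at `Y`, which
straightens. -/
lemma coev_dualMap {X Y : C} (f : X ⟶ Y) : coev Y ≫ dualMap f ▷ Y = coev X ≫ dual X ◁ f := by
  calc
    _ = 𝟙 _ ⊗≫ (𝟙_ C ◁ coev Y ≫ coev X ▷ (dual Y ⊗ Y)) ⊗≫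
          dual X ◁ (f ▷ dual Y ≫ ev Y) ▷ Y ⊗≫ 𝟙 _ := by
      rw [dualMap, toDual]; monoidal
    _ = coev X ⊗≫ dual X ◁ (X ◁ coev Y ≫ f ▷ (dual Y ⊗ Y)) ⊗≫ dual X ◁ (ev Y ▷ Y) ⊗≫ 𝟙 _ := by
      rw [whisker_exchange]; monoidal
    _ = coev X ≫ dual X ◁ f ⊗≫ dual X ◁ (Y ◁ coev Y ⊗≫ ev Y ▷ Y) ⊗≫ 𝟙 _ := by
      rw [whisker_exchange]; monoidal
    _ = _ := by
      rw [zigzag_left]; monoidal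

@[simp]
lemma dualMap_id (X : C) : dualMap (𝟙 X) = 𝟙 (dual X) :=
  dual_hom_ext (by rw [whiskerLeft_dualMap_ev]; simp)

lemma dualMap_comp {X Y Z : C} (f : X ⟶ Y) (g : Y ⟶ Z) :
    dualMap (f ≫ g) = dualMap g ≫ dualMap f := by
  apply dual_hom_ext
  rw [whiskerLeft_dualMap_ev, MonoidalCategory.whiskerLeft_comp, Category.assoc,
    whiskerLeft_dualMap_ev, whisker_exchange_assoc, whiskerLeft_dualMap_ev, comp_whiskerRight,
    Category.assoc]

lemma isIso_dualMap {X Y : C} (f : X ⟶ Y) [IsIso f] : IsIso (dualMap f) :=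
  ⟨dualMap (inv f), by rw [← dualMap_comp]; simp, by rw [← dualMap_comp]; simp⟩

/-- Identifies the canonical map with the comparison of two duals of `X ⊗ Y`, so that its
invertibility and its effect on coevaluations follow from the general results on exact pairings. -/
lemma dualTensor_eq (X Y : C) :
    dualTensor X Y = toDual (ExactPairing.evaluation (dual Y ⊗ dual X) (X ⊗ Y)) := by
  rw [dualTensor, ExactPairing.tensor_evaluation, ← ev_eq, ← ev_eq]
  congr 1
  monoidal

lemma dualUnit_eq : dualUnit C = toDual (ExactPairing.evaluation (𝟙_ C) (𝟙_ C)) := by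
  rw [dualUnit]
  congr 1
  change (λ_ (𝟙_ C)).hom = (ρ_ (𝟙_ C)).hom
  monoidal

instance isIso_dualTensor (X Y : C) : IsIso (dualTensor X Y) := by
  rw [dualTensor_eq]; exact isIso_toDual_evaluation _ _

instance isIso_dualUnit : IsIso (dualUnit C) := by
  rw [dualUnit_eq]; exact isIso_toDual_evaluation _ _

lemma whiskerLeft_dualTensor_ev (X Y : C) :
    (X ⊗ Y) ◁ dualTensor X Y ≫ ev (X ⊗ Y) = 𝟙 _ ⊗≫ X ◁ (ev Y ▷ dual X) ⊗≫ ev X := by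
  rw [dualTensor, whiskerLeft_toDual_ev]
  monoidal

lemma coev_tensor (X Y : C) :
    coev (X ⊗ Y) = (coev Y ⊗≫ (dual Y ◁ coev X) ▷ Y ⊗≫ 𝟙 _) ≫ dualTensor X Y ▷ (X ⊗ Y) := by
  rw [dualTensor_eq, ← coevaluation_toDual (X ⊗ Y) (dual Y ⊗ dual X)]
  rfl

end Duals

/-! ### Pivotal structure, loops and traces -/

section Pivotal

variable {C : Type u₁} [Category.{v₁} C] [MonoidalCategory C] [PivotalCategory C]

lemma piv_inv_natural {X Y : C} (f : X ⟶ Y) :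
    (piv X).inv ≫ f = dualMap (dualMap f) ≫ (piv Y).inv := by
  rw [Iso.inv_comp_eq, ← Category.assoc, ← piv_natural, Category.assoc, Iso.hom_inv_id,
    Category.comp_id]

lemma dualMap_evTilde {X Y : C} (f : X ⟶ Y) :
    dualMap f ▷ X ≫ evTilde X = dual Y ◁ f ≫ evTilde Y := by
  rw [evTilde, evTilde, ← whisker_exchange_assoc, ← whiskerLeft_dualMap_ev,
    ← whiskerLeft_comp_assoc, ← piv_natural, whiskerLeft_comp_assoc]

lemma coevTilde_whiskerRight {X Y : C} (f : X ⟶ Y) :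
    coevTilde X ≫ f ▷ dual X = coevTilde Y ≫ Y ◁ dualMap f := by
  rw [coevTilde, coevTilde, Category.assoc, Category.assoc, ← comp_whiskerRight,
    piv_inv_natural, comp_whiskerRight, reassoc_of% coev_dualMap, whisker_exchange]

lemma dualUnit_dualMap_ev (X : C) :
    dualUnit C ≫ dualMap (ev X) = coev (dual X) ≫ dualTensor X (dual X) := by
  apply dual_hom_ext
  rw [MonoidalCategory.whiskerLeft_comp, Category.assoc, whiskerLeft_dualMap_ev,
    whisker_exchange_assoc, MonoidalCategory.whiskerLeft_comp, Category.assoc,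
    whiskerLeft_dualTensor_ev, dualUnit, whiskerLeft_toDual_ev]
  calc
    _ = 𝟙 _ ⊗≫ X ◁ (⊗𝟙.hom : dual X ⊗ 𝟙_ C ⟶ 𝟙_ C ⊗ dual X) ⊗≫ ev X := by monoidal
    _ = 𝟙 _ ⊗≫ X ◁ (dual X ◁ coev (dual X) ⊗≫ ev (dual X) ▷ dual X) ⊗≫ ev X := by
      rw [← zigzag_left]
    _ = _ := by monoidal

lemma dualTensor_dualMap_coev (X : C) :
    dualTensor (dual X) X ≫ dualMap (coev X) = ev (dual X) ≫ dualUnit C := by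
  apply dual_hom_ext
  rw [MonoidalCategory.whiskerLeft_comp, Category.assoc, whiskerLeft_dualMap_ev,
    whisker_exchange_assoc, MonoidalCategory.whiskerLeft_comp, Category.assoc,
    whiskerLeft_dualTensor_ev, dualUnit, whiskerLeft_toDual_ev]
  calc
    _ = 𝟙 _ ⊗≫ (coev X ▷ dual X ⊗≫ dual X ◁ ev X) ▷ dual (dual X) ⊗≫ ev (dual X) := by monoidal
    _ = 𝟙 _ ⊗≫ (⊗𝟙.hom : 𝟙_ C ⊗ dual X ⟶ dual X ⊗ 𝟙_ C) ▷ dual (dual X) ⊗≫ ev (dual X) := by rw [zigzag_right]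
    _ = _ := by monoidal

/-- Naturality of the pivotal structure at `ev X`, with both monoidality axioms. The two preceding
lemmas say that the double dual of `ev X` is `ev (dual (dual X))` up to the canonical isomorphisms.
-/
lemma piv_tensor_piv_ev (X : C) :
    ((piv X).hom ⊗ₘ (piv (dual X)).hom) ≫ ev (dual (dual X)) = ev X := by
  rw [← cancel_mono (dualUnit C), Category.assoc, ← dualTensor_dualMap_coev,
    ← Category.assoc, ← piv_tensor, Category.assoc, ← dualMap_comp, ← dualUnit_dualMap_ev,
    dualMap_comp, ← Category.assoc, ← piv_natural, Category.assoc, piv_unit]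

/-- The pivotal structure of a dual object is inverse to the dual of the pivotal structure. -/
lemma piv_dual_dualMap_piv (X : C) :
    (piv (dual X)).hom ≫ dualMap (piv X).hom = 𝟙 (dual X) := by
  apply dual_hom_ext
  rw [MonoidalCategory.whiskerLeft_comp, Category.assoc, whiskerLeft_dualMap_ev,
    whisker_exchange_assoc, ← tensorHom_def_assoc, piv_tensor_piv_ev]
  simp

/-- Reversing the orientation of a loop exchanges the two traces. Sphericality then gives
`dim_dual`. -/
lemma trR_id_dual (X : C) : trR (𝟙 (dual X)) = trL (𝟙 X) := by
  have h : dualMap (piv X).hom = (piv (dual X)).inv := by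
    rw [← cancel_epi (piv (dual X)).hom, piv_dual_dualMap_piv, Iso.hom_inv_id]
  rw [trR, trL, id_whiskerRight, Category.id_comp, MonoidalCategory.whiskerLeft_id,
    Category.id_comp, evTilde, coevTilde, ← h, Category.assoc, reassoc_of% coev_dualMap]

/-- The morphism `f` slides once around the loop, passing the return strand as its dual. -/
lemma trR_comp_comm {X Y : C} (f : X ⟶ Y) (g : Y ⟶ X) : trR (f ≫ g) = trR (g ≫ f) := by
  rw [trR, trR, comp_whiskerRight, comp_whiskerRight, Category.assoc, Category.assoc,
    reassoc_of% coevTilde_whiskerRight, ← whiskerLeft_dualMap_ev f, whisker_exchange_assoc]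

lemma coevTilde_tensor (X Y : C) :
    coevTilde (X ⊗ Y) = (coevTilde X ⊗≫ (X ◁ coevTilde Y) ▷ dual X ⊗≫ 𝟙 _) ≫
      (X ⊗ Y) ◁ dualTensor X Y := by
  have hp : coevTilde (X ⊗ Y) ≫ (piv (X ⊗ Y)).hom ▷ dual (X ⊗ Y) = coev (dual (X ⊗ Y)) := by
    simp [coevTilde, ← comp_whiskerRight]
  have hn : (coevTilde X ⊗≫ (X ◁ coevTilde Y) ▷ dual X ⊗≫ 𝟙 _) ≫
      ((piv X).hom ⊗ₘ (piv Y).hom) ▷ (dual Y ⊗ dual X) =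
      coev (dual X) ⊗≫ (dual (dual X) ◁ coev (dual Y)) ▷ dual X ⊗≫ 𝟙 _ := by
    have h1 : (coevTilde X ⊗≫ (X ◁ coevTilde Y) ▷ dual X ⊗≫ 𝟙 _) ≫
        ((piv X).hom ⊗ₘ (piv Y).hom) ▷ (dual Y ⊗ dual X) =
        coevTilde X ⊗≫ (X ◁ coevTilde Y ≫ (piv X).hom ▷ (Y ⊗ dual Y) ≫
          dual (dual X) ◁ ((piv Y).hom ▷ dual Y)) ▷ dual X ⊗≫ 𝟙 _ := by
      rw [MonoidalCategory.tensorHom_def]; monoidal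
    rw [h1, whisker_exchange_assoc, ← MonoidalCategory.whiskerLeft_comp]
    have h2 (Z : C) : coevTilde Z ≫ (piv Z).hom ▷ dual Z = coev (dual Z) := by
      simp [coevTilde, ← comp_whiskerRight]
    rw [h2, ← h2 X]
    monoidal
  have := isIso_dualMap (dualTensor X Y)
  -- Composing with the pivotal isomorphism turns second coevaluations into ordinary ones, for which
  -- nesting is known. Monoidality of the pivotal structure matches the two sides.
  rw [← cancel_mono ((piv (X ⊗ Y)).hom ▷ dual (X ⊗ Y)), hp,
    ← cancel_mono (dualMap (dualTensor X Y) ▷ dual (X ⊗ Y)), coev_dualMap, coev_tensor, ← hn]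
  simp only [Category.assoc]
  rw [← comp_whiskerRight, piv_tensor, whisker_exchange, comp_whiskerRight_assoc]

/-- The loop of a tensor product is two concentric circles. The inner one is an endomorphism of the
unit, which `dim_tensor` extracts as a scalar. -/
lemma trR_id_tensor (X Y : C) :
    trR (𝟙 (X ⊗ Y)) =
      coevTilde X ≫ (𝟙 _ ⊗≫ X ◁ trR (𝟙 Y) ⊗≫ 𝟙 X) ▷ dual X ≫ ev X := by
  simp only [trR, id_whiskerRight, Category.id_comp]
  rw [coevTilde_tensor, Category.assoc, whiskerLeft_dualTensor_ev]
  monoidal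

end Pivotal

/-! ### Monoidal functors and duals -/

section Functors

open Functor.LaxMonoidal Functor.OplaxMonoidal Functor.Monoidal

variable {C : Type u₁} [Category.{v₁} C] [MonoidalCategory C]
  {D : Type u₂} [Category.{v₂} D] [MonoidalCategory D] (F : C ⥤ D) [F.Monoidal]

/-- The image of an exact pairing under a strong monoidal functor. -/
abbrev mapExactPairing (Y X : C) [ExactPairing Y X] : ExactPairing (F.obj Y) (F.obj X) where
  coevaluation' := ε F ≫ F.map (ExactPairing.coevaluation Y X) ≫ δ F Y X
  evaluation' := μ F X Y ≫ F.map (ExactPairing.evaluation Y X) ≫ η F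
  coevaluation_evaluation' := by
    have := congrArg F.map (ExactPairing.coevaluation_evaluation Y X)
    simp only [Functor.map_comp, map_whiskerLeft, map_whiskerRight, map_associator_inv,
      map_rightUnitor, map_leftUnitor_inv, Category.assoc, μ_δ_assoc] at this
    rw [← cancel_epi (δ F X (𝟙_ C) ≫ F.obj X ◁ η F), ← cancel_mono (ε F ▷ F.obj X ≫ μ F _ _)]
    simp only [MonoidalCategory.whiskerLeft_comp, comp_whiskerRight, Category.assoc,
      whiskerLeft_η_ε_assoc, whiskerRight_η_ε_assoc] at this ⊢
    exact this
  evaluation_coevaluation' := by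
    have := congrArg F.map (ExactPairing.evaluation_coevaluation Y X)
    simp only [Functor.map_comp, map_whiskerLeft, map_whiskerRight, map_associator,
      map_rightUnitor_inv, map_leftUnitor, Category.assoc, μ_δ_assoc] at this
    rw [← cancel_epi (δ F (𝟙_ C) Y ≫ η F ▷ F.obj Y), ← cancel_mono (F.obj Y ◁ ε F ≫ μ F _ _)]
    simp only [MonoidalCategory.whiskerLeft_comp, comp_whiskerRight, Category.assoc,
      whiskerLeft_η_ε_assoc, whiskerRight_η_ε_assoc] at this ⊢
    exact this

section Rigid

variable [LeftRigidCategory C] [LeftRigidCategory D]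

lemma whiskerLeft_dualComparison_ev (X : C) :
    δ F X (dual X) ≫ F.obj X ◁ dualComparison F X ≫ ev (F.obj X) = F.map (ev X) ≫ η F := by
  rw [dualComparison, whiskerLeft_toDual_ev]
  simp

lemma map_coev_dualComparison (X : C) :
    F.map (coev X) ≫ δ F (dual X) X ≫ dualComparison F X ▷ F.obj X =
      η F ≫ coev (F.obj X) := by
  let _ := mapExactPairing F (dual X) X
  rw [← coevaluation_toDual (F.obj X) (F.obj (dual X))]
  change _ = η F ≫ (ε F ≫ F.map (coev X) ≫ δ F (dual X) X) ≫ _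
  simp only [Category.assoc, η_ε_assoc]
  rfl

instance isIso_dualComparison (X : C) : IsIso (dualComparison F X) := by
  let _ := mapExactPairing F (dual X) X
  exact isIso_toDual_evaluation (F.obj X) (F.obj (dual X))

end Rigid

section Pivotal

variable [PivotalCategory C] [PivotalCategory D] {F}

/-- The second evaluation contains the pivotal structure, so here a strong monoidal functor does not
suffice and pivotality enters. -/
lemma IsPivotal.whiskerRight_dualComparison_evTilde (hF : IsPivotal F) (X : C) :
    δ F (dual X) X ≫ dualComparison F X ▷ F.obj X ≫ evTilde (F.obj X) =
      F.map (evTilde X) ≫ η F := by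
  rw [evTilde, evTilde, ← whisker_exchange_assoc, ← whiskerLeft_dualMap_ev,
    ← whiskerLeft_comp_assoc, hF, whiskerLeft_comp_assoc, δ_natural_right_assoc,
    whiskerLeft_dualComparison_ev, F.map_comp_assoc]

lemma IsPivotal.map_coevTilde_dualComparison (hF : IsPivotal F) (X : C) :
    F.map (coevTilde X) ≫ δ F X (dual X) ≫ F.obj X ◁ dualComparison F X =
      η F ≫ coevTilde (F.obj X) := by
  have := isIso_dualMap (dualComparison F X)
  have h : (piv (F.obj X)).hom ≫ dualMap (dualComparison F X) =
    F.map (piv X).hom ≫ dualComparison F (dual X) := hF X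
  rw [← cancel_mono ((piv (F.obj X)).hom ▷ dual (F.obj X)),
    ← cancel_mono (dualMap (dualComparison F X) ▷ dual (F.obj X))]
  simp only [coevTilde, Category.assoc, inv_hom_whiskerRight_assoc, F.map_comp]
  rw [coev_dualMap, ← comp_whiskerRight, h, whisker_exchange, ← δ_natural_left_assoc,
    ← comp_whiskerRight_assoc, ← F.map_comp_assoc, Iso.inv_hom_id, F.map_id, Category.id_comp,
    ← reassoc_of% map_coev_dualComparison F (dual X)]

lemma IsPivotal.map_trR_id (hF : IsPivotal F) (X : C) :
    F.map (trR (𝟙 X)) ≫ η F = η F ≫ trR (𝟙 (F.obj X)) := by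
  simp only [trR, id_whiskerRight, Category.id_comp, F.map_comp, Category.assoc]
  rw [← whiskerLeft_dualComparison_ev, reassoc_of% hF.map_coevTilde_dualComparison X]

end Pivotal

end Functors

/-! ### Morphisms between strands -/

section Strands

variable {C : Type u₁} [Category.{v₁} C] [MonoidalCategory C]

/-- Formulated for arbitrary objects, so that one computation serves both orientations, both the
sliding of insertions and the change of labels. -/
lemma cup_natural {A A' B B' W W' : C} {c : 𝟙_ C ⟶ A ⊗ B} {c' : 𝟙_ C ⟶ A' ⊗ B'} {f : A ⟶ A'}
    {g : B ⟶ B'} (t : W ⟶ W') (h : c ≫ (f ⊗ₘ g) = c') :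
    ((λ_ W).inv ≫ c ▷ W ≫ (α_ A B W).hom) ≫ (f ⊗ₘ (g ⊗ₘ t)) =
      t ≫ ((λ_ W').inv ≫ c' ▷ W' ≫ (α_ A' B' W').hom) := by
  rw [leftUnitor_inv_naturality_assoc, whisker_exchange_assoc, Category.assoc, Category.assoc,
    ← associator_naturality, MonoidalCategory.tensorHom_def _ t, Category.assoc,
    ← comp_whiskerRight_assoc, h]

lemma cap_natural {A A' B B' W W' : C} {c : A ⊗ B ⟶ 𝟙_ C} {c' : A' ⊗ B' ⟶ 𝟙_ C} {f : A ⟶ A'}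
    {g : B ⟶ B'} (t : W ⟶ W') (h : (f ⊗ₘ g) ≫ c' = c) :
    (f ⊗ₘ (g ⊗ₘ t)) ≫ ((α_ A' B' W').inv ≫ c' ▷ W' ≫ (λ_ W').hom) =
      ((α_ A B W).inv ≫ c ▷ W ≫ (λ_ W).hom) ≫ t := by
  rw [associator_inv_naturality_assoc, tensorHom_def' _ t, Category.assoc,
    ← comp_whiskerRight_assoc, h, whisker_exchange_assoc, leftUnitor_naturality, Category.assoc,
    Category.assoc]

lemma cross_natural {A A' B B' W W' : C} {c : A ⊗ B ⟶ B ⊗ A} {c' : A' ⊗ B' ⟶ B' ⊗ A'}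
    {f : A ⟶ A'} {g : B ⟶ B'} (t : W ⟶ W') (h : (f ⊗ₘ g) ≫ c' = c ≫ (g ⊗ₘ f)) :
    (f ⊗ₘ (g ⊗ₘ t)) ≫ ((α_ A' B' W').inv ≫ c' ▷ W' ≫ (α_ B' A' W').hom) =
      ((α_ A B W).inv ≫ c ▷ W ≫ (α_ B A W).hom) ≫ (g ⊗ₘ (f ⊗ₘ t)) := by
  rw [associator_inv_naturality_assoc, tensorHom_def' _ t, Category.assoc,
    ← comp_whiskerRight_assoc, h, comp_whiskerRight_assoc, whisker_exchange_assoc, Category.assoc,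
    Category.assoc, ← associator_naturality, tensorHom_def' _ t, Category.assoc]

lemma cup_slide {A B W : C} {c : 𝟙_ C ⟶ A ⊗ B} {f : A ⟶ A} {g : B ⟶ B}
    (h : c ≫ f ▷ B = c ≫ A ◁ g) :
    ((λ_ W).inv ≫ c ▷ W ≫ (α_ A B W).hom) ≫ f ▷ (B ⊗ W) =
      ((λ_ W).inv ≫ c ▷ W ≫ (α_ A B W).hom) ≫ A ◁ (g ▷ W) := by
  calc
    _ = (λ_ W).inv ≫ (c ≫ f ▷ B) ▷ W ≫ (α_ A B W).hom := by monoidal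
    _ = _ := by rw [h]; monoidal

lemma cap_slide {A B W : C} {c : A ⊗ B ⟶ 𝟙_ C} {f : A ⟶ A} {g : B ⟶ B}
    (h : f ▷ B ≫ c = A ◁ g ≫ c) :
    f ▷ (B ⊗ W) ≫ ((α_ A B W).inv ≫ c ▷ W ≫ (λ_ W).hom) =
      A ◁ (g ▷ W) ≫ ((α_ A B W).inv ≫ c ▷ W ≫ (λ_ W).hom) := by
  calc
    _ = (α_ A B W).inv ≫ (f ▷ B ≫ c) ▷ W ≫ (λ_ W).hom := by monoidal
    _ = _ := by rw [h]; monoidal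

section Rigid

variable [LeftRigidCategory C]

/-- A morphism between signed objects: an upward strand carries `f`, a downward strand `g*`. -/
def signedHom {X Y : C} (f : X ⟶ Y) (g : Y ⟶ X) : (b : Bool) → (signed X b ⟶ signed Y b)
  | true => f
  | false => dualMap g

@[simp]
lemma signedHom_id (X : C) (b : Bool) : signedHom (𝟙 X) (𝟙 X) b = 𝟙 (signed X b) := by
  cases b
  · exact dualMap_id X
  · rfl

lemma signedHom_comp {X Y Z : C} (f : X ⟶ Y) (g : Y ⟶ X) (f' : Y ⟶ Z) (g' : Z ⟶ Y) (b : Bool) :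
    signedHom f g b ≫ signedHom f' g' b = signedHom (f ≫ f') (g' ≫ g) b := by
  cases b
  · exact (dualMap_comp g' g).symm
  · rfl

variable {κ : Type} {V W U : κ → C}

/-- The tensor product of morphisms between the strands in a list, which may depend on the position
of the strand. -/
def strandsHom (f : ℕ → ∀ k, V k ⟶ W k) (g : ℕ → ∀ k, W k ⟶ V k) :
    (w : List (κ × Bool)) → (strandsObj V w ⟶ strandsObj W w)
  | [] => 𝟙 _
  | x :: w => signedHom (f 0 x.1) (g 0 x.1) x.2 ⊗ₘ
      strandsHom (fun p => f (p + 1)) (fun p => g (p + 1)) w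

lemma strandsHom_id (w : List (κ × Bool)) :
    strandsHom (fun _ k => 𝟙 (V k)) (fun _ k => 𝟙 (V k)) w = 𝟙 (strandsObj V w) := by
  induction w with
  | nil => rfl
  | cons x w ih => simp only [strandsHom, ih, signedHom_id]; exact id_tensorHom_id _ _

lemma strandsHom_comp (f : ℕ → ∀ k, V k ⟶ W k) (g : ℕ → ∀ k, W k ⟶ V k)
    (f' : ℕ → ∀ k, W k ⟶ U k) (g' : ℕ → ∀ k, U k ⟶ W k) (w : List (κ × Bool)) :
    strandsHom f g w ≫ strandsHom f' g' w =
      strandsHom (fun p k => f p k ≫ f' p k) (fun p k => g' p k ≫ g p k) w := by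
  induction w generalizing f g f' g' with
  | nil => exact Category.id_comp _
  | cons x w ih =>
    refine (tensorHom_comp_tensorHom _ _ _ _).trans ?_
    rw [ih, signedHom_comp]
    rfl

open Classical in
/-- The insertion of the endomorphisms `e` on the strands whose position belongs to `S`. -/
noncomputable def strandsEnd (e : ∀ k, V k ⟶ V k) (S : Set ℕ) (w : List (κ × Bool)) :
    strandsObj V w ⟶ strandsObj V w :=
  strandsHom (fun p k => if p ∈ S then e k else 𝟙 _) (fun p k => if p ∈ S then e k else 𝟙 _) w

lemma strandsEnd_univ (e : ∀ k, V k ⟶ V k) (w : List (κ × Bool)) :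
    strandsEnd e Set.univ w = strandsHom (fun _ => e) (fun _ => e) w := by
  simp [strandsEnd]

@[simp]
lemma strandsEnd_empty (e : ∀ k, V k ⟶ V k) (w : List (κ × Bool)) :
    strandsEnd e ∅ w = 𝟙 _ := by
  simp [strandsEnd, strandsHom_id]

lemma strandsEnd_singleton_zero (e : ∀ k, V k ⟶ V k) (x : κ × Bool) (w : List (κ × Bool)) :
    strandsEnd e {0} (x :: w) = signedHom (e x.1) (e x.1) x.2 ▷ strandsObj V w := by
  simp only [strandsEnd, strandsHom, Set.mem_singleton_iff, if_true, Nat.succ_ne_zero, if_false,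
    strandsHom_id]
  exact tensorHom_id _ _

open Classical in
lemma strandsEnd_image_succ (e : ∀ k, V k ⟶ V k) (S : Set ℕ) (x : κ × Bool)
    (w : List (κ × Bool)) :
    strandsEnd e (Nat.succ '' S) (x :: w) = signed (V x.1) x.2 ◁ strandsEnd e S w := by
  have h0 : (0 : ℕ) ∉ Nat.succ '' S := by simp
  have h1 : (fun (p : ℕ) (k : κ) => if p + 1 ∈ Nat.succ '' S then e k else 𝟙 (V k)) =
      fun p k => if p ∈ S then e k else 𝟙 (V k) := by ext p k; simp
  simp only [strandsEnd, strandsHom, h0, if_false, signedHom_id]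
  rw [h1]
  exact id_tensorHom (C := C) _ _

lemma strandsEnd_singleton_succ (e : ∀ k, V k ⟶ V k) (p : ℕ) (x : κ × Bool)
    (w : List (κ × Bool)) :
    strandsEnd e {p + 1} (x :: w) = signed (V x.1) x.2 ◁ strandsEnd e {p} w := by
  have h := strandsEnd_image_succ e {p} x w
  rwa [Set.image_singleton] at h

/-- Idempotence is needed exactly at positions in `S ∩ T`. It is what allows insertions to be
recorded by sets of points without multiplicities. -/
lemma strandsEnd_union (e : ∀ k, V k ⟶ V k) (he : ∀ k, e k ≫ e k = e k) (S T : Set ℕ)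
    (w : List (κ × Bool)) :
    strandsEnd e (S ∪ T) w = strandsEnd e S w ≫ strandsEnd e T w := by
  rw [strandsEnd, strandsEnd, strandsEnd, strandsHom_comp]
  congr 1 <;> ext p k <;> by_cases hS : p ∈ S <;> by_cases hT : p ∈ T <;> simp [hS, hT, he]

open Classical in
lemma strandsEnd_congr (e : ∀ k, V k ⟶ V k) (k : κ) (he : ∀ j, j ≠ k → e j = 𝟙 _)
    (w : List (κ × Bool)) (S T : Set ℕ)
    (h : ∀ p b, w[p]? = some (k, b) → (p ∈ S ↔ p ∈ T)) :
    strandsEnd e S w = strandsEnd e T w := by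
  induction w generalizing S T with
  | nil => rfl
  | cons x w ih =>
    have h0 : (if 0 ∈ S then e x.1 else 𝟙 _) = (if 0 ∈ T then e x.1 else 𝟙 _) := by
      by_cases hx : x.1 = k
      · have := h 0 x.2 (by simp [← hx])
        simp [this]
      · simp [he _ hx]
    have := ih {p | p + 1 ∈ S} {p | p + 1 ∈ T} (fun p b hp => h (p + 1) b (by simpa using hp))
    simp only [strandsEnd, strandsHom, h0, Set.mem_ofPred_eq] at this ⊢
    rw [this]

end Rigid

section Pivotal

variable [PivotalCategory C]

lemma cupMap_whiskerRight {X Y : C} (f : X ⟶ Y) (g : Y ⟶ X) (b : Bool) :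
    cupMap X b ≫ signedHom f g b ▷ signed X (!b) =
      cupMap Y b ≫ signed Y b ◁ signedHom g f (!b) := by
  cases b
  · exact (coev_dualMap g)
  · exact coevTilde_whiskerRight f

lemma whiskerRight_capMap {X Y : C} (f : X ⟶ Y) (g : Y ⟶ X) (b : Bool) :
    signedHom f g b ▷ signed Y (!b) ≫ capMap Y b =
      signed X b ◁ signedHom g f (!b) ≫ capMap X b := by
  cases b
  · exact dualMap_evTilde g
  · exact (whiskerLeft_dualMap_ev f).symm

end Pivotal

lemma crossMap_natural [BraidedCategory C] {X X' Y Y' : C} (f : X ⟶ X') (g : Y ⟶ Y') (o : Bool) :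
    (f ⊗ₘ g) ≫ crossMap X' Y' o = crossMap X Y o ≫ (g ⊗ₘ f) := by
  cases o
  · change (f ⊗ₘ g) ≫ (β_ Y' X').inv = (β_ Y X).inv ≫ (g ⊗ₘ f)
    simp
  · change (f ⊗ₘ g) ≫ (β_ X' Y').hom = (β_ X Y).hom ≫ (g ⊗ₘ f)
    simp

end Strands

/-! ### Insertion of endomorphisms into diagrams -/

section Insertion

variable {C : Type u₁} [Category.{v₁} C] [MonoidalCategory C] [PivotalCategory C]
  [BraidedCategory C] {κ : Type} {V : κ → C}

/-- A slice with endomorphisms inserted at the boundary points in `U`. -/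
noncomputable def Slice.evalInsert (e : ∀ k, V k ⟶ V k) (U : Set (ℕ ⊕ ℕ))
    {w w' : List (κ × Bool)} (s : Slice κ w w') : strandsObj V w ⟶ strandsObj V w' :=
  strandsEnd e (Sum.inl ⁻¹' U) w ≫ s.eval V ≫ strandsEnd e (Sum.inr ⁻¹' U) w'

lemma Slice.evalInsert_inl (e : ∀ k, V k ⟶ V k) (p : ℕ) {w w' : List (κ × Bool)}
    (s : Slice κ w w') : s.evalInsert e {Sum.inl p} = strandsEnd e {p} w ≫ s.eval V := by
  have h1 : Sum.inl ⁻¹' ({Sum.inl p} : Set (ℕ ⊕ ℕ)) = {p} := by ext; simp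
  have h2 : Sum.inr ⁻¹' ({Sum.inl p} : Set (ℕ ⊕ ℕ)) = ∅ := by ext; simp
  rw [evalInsert, h1, h2, strandsEnd_empty, Category.comp_id]

lemma Slice.evalInsert_inr (e : ∀ k, V k ⟶ V k) (p : ℕ) {w w' : List (κ × Bool)}
    (s : Slice κ w w') : s.evalInsert e {Sum.inr p} = s.eval V ≫ strandsEnd e {p} w' := by
  have h1 : Sum.inr ⁻¹' ({Sum.inr p} : Set (ℕ ⊕ ℕ)) = {p} := by ext; simp
  have h2 : Sum.inl ⁻¹' ({Sum.inr p} : Set (ℕ ⊕ ℕ)) = ∅ := by ext; simp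
  rw [evalInsert, h1, h2, strandsEnd_empty, Category.id_comp]

lemma Slice.evalInsert_wire (e : ∀ k, V k ⟶ V k) (P : ℕ ⊕ ℕ) (x : κ × Bool)
    {w w' : List (κ × Bool)} (s : Slice κ w w') :
    (Slice.wire x s).evalInsert e {P.map Nat.succ Nat.succ} =
      signed (V x.1) x.2 ◁ s.evalInsert e {P} := by
  rcases P with p | p
  · simp only [Sum.map_inl, evalInsert_inl, MonoidalCategory.whiskerLeft_comp, Slice.eval]
    rw [← strandsEnd_singleton_succ]; rfl
  · simp only [Sum.map_inr, evalInsert_inr, MonoidalCategory.whiskerLeft_comp, Slice.eval]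
    rw [← strandsEnd_singleton_succ]; rfl

/-- An endomorphism slides along an arc of a slice. -/
lemma Slice.evalInsert_eq_of_joins (e : ∀ k, V k ⟶ V k) {w w' : List (κ × Bool)}
    {s : Slice κ w w'} {P Q : ℕ ⊕ ℕ} (h : s.Joins P Q) :
    s.evalInsert e {P} = s.evalInsert e {Q} := by
  induction h with
  | cup_turn k b w =>
    rw [evalInsert_inr, evalInsert_inr, strandsEnd_singleton_zero, ← zero_add 1,
      strandsEnd_singleton_succ, strandsEnd_singleton_zero]
    exact cup_slide (cupMap_whiskerRight (e k) (e k) b)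
  | cup_rest k b w p =>
    rw [evalInsert_inl, evalInsert_inr, strandsEnd_singleton_succ, strandsEnd_singleton_succ]
    have := cup_natural (c := cupMap (V k) b) (f := 𝟙 _) (g := 𝟙 _) (strandsEnd e {p} w)
      (by rw [id_tensorHom_id, Category.comp_id])
    simp only [id_tensorHom] at this
    exact this.symm
  | cap_turn k b w =>
    rw [evalInsert_inl, evalInsert_inl, strandsEnd_singleton_zero, ← zero_add 1,
      strandsEnd_singleton_succ, strandsEnd_singleton_zero]
    exact cap_slide (whiskerRight_capMap (e k) (e k) b)
  | cap_rest k b w p =>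
    rw [evalInsert_inl, evalInsert_inr, strandsEnd_singleton_succ, strandsEnd_singleton_succ]
    have := cap_natural (c' := capMap (V k) b) (f := 𝟙 _) (g := 𝟙 _) (strandsEnd e {p} w)
      (by rw [id_tensorHom_id, Category.id_comp])
    simp only [id_tensorHom] at this
    exact this
  | cross_right x y o w =>
    rw [evalInsert_inl, evalInsert_inr, strandsEnd_singleton_zero, ← zero_add 1,
      strandsEnd_singleton_succ, strandsEnd_singleton_zero]
    have := cross_natural (𝟙 (strandsObj V w))
      (crossMap_natural (signedHom (e x.1) (e x.1) x.2) (𝟙 (signed (V y.1) y.2)) o)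
    rw [id_tensorHom_id, tensorHom_id, id_tensorHom, tensorHom_id] at this
    exact this
  | cross_left x y o w =>
    rw [evalInsert_inl, evalInsert_inr, strandsEnd_singleton_zero, ← zero_add 1,
      strandsEnd_singleton_succ, strandsEnd_singleton_zero]
    have := cross_natural (𝟙 (strandsObj V w))
      (crossMap_natural (𝟙 (signed (V x.1) x.2)) (signedHom (e y.1) (e y.1) y.2) o)
    rw [id_tensorHom_id, tensorHom_id, id_tensorHom, tensorHom_id] at this
    exact this
  | cross_rest x y o w p =>
    rw [evalInsert_inl, evalInsert_inr, strandsEnd_singleton_succ, strandsEnd_singleton_succ,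
      strandsEnd_singleton_succ, strandsEnd_singleton_succ]
    have := cross_natural (strandsEnd e {p} w)
      (crossMap_natural (𝟙 (signed (V x.1) x.2)) (𝟙 (signed (V y.1) y.2)) o)
    simp only [id_tensorHom] at this
    exact this
  | wire_first x s =>
    rw [evalInsert_inl, evalInsert_inr, strandsEnd_singleton_zero, strandsEnd_singleton_zero]
    exact (whisker_exchange _ _).symm
  | wire_rest x s h ih => rw [evalInsert_wire, evalInsert_wire, ih]

/-- A diagram with endomorphisms inserted at the points (height, position) in `S`. -/
noncomputable def Diagram.evalInsert (e : ∀ k, V k ⟶ V k) :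
    {w w' : List (κ × Bool)} → Set (ℕ × ℕ) → Diagram κ w w' → (strandsObj V w ⟶ strandsObj V w')
  | _, _, S, .nil w => strandsEnd e {p | (0, p) ∈ S} w
  | w, _, S, .cons s d => strandsEnd e {p | (0, p) ∈ S} w ≫ s.eval V ≫
      d.evalInsert e {P | (P.1 + 1, P.2) ∈ S}

variable {e : ∀ k, V k ⟶ V k}

lemma Diagram.evalInsert_bottom_union (he : ∀ k, e k ≫ e k = e k) {w w' : List (κ × Bool)}
    (d : Diagram κ w w') (T : Set ℕ) (S : Set (ℕ × ℕ)) :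
    d.evalInsert e (Prod.mk 0 '' T ∪ S) = strandsEnd e T w ≫ d.evalInsert e S := by
  have h0 : {p | (0, p) ∈ Prod.mk 0 '' T ∪ S} = T ∪ {p | (0, p) ∈ S} := by ext; simp
  cases d with
  | nil => rw [evalInsert, evalInsert, h0, strandsEnd_union e he]
  | cons s d =>
    have h1 : {P : ℕ × ℕ | (P.1 + 1, P.2) ∈ Prod.mk 0 '' T ∪ S} = {P | (P.1 + 1, P.2) ∈ S} := by
      ext; simp
    rw [evalInsert, evalInsert, h0, h1, strandsEnd_union e he, Category.assoc]

/-- Isolates an additional insertion on the boundary of the lowest slice, so that it can be slid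
inside that slice while all other insertions stay fixed. -/
lemma Diagram.evalInsert_cons_union (he : ∀ k, e k ≫ e k = e k) {w w' w'' : List (κ × Bool)}
    (s : Slice κ w w') (d : Diagram κ w' w'') (P : ℕ ⊕ ℕ) (S : Set (ℕ × ℕ)) :
    (Diagram.cons s d).evalInsert e (insert (bottomPoint P) S) =
      strandsEnd e {p | (0, p) ∈ S} w ≫ s.evalInsert e {P} ≫
        d.evalInsert e {P | (P.1 + 1, P.2) ∈ S} := by
  rcases P with p | p
  · have h0 : {q | (0, q) ∈ insert (bottomPoint (Sum.inl p)) S} = {q | (0, q) ∈ S} ∪ {p} := by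
      ext; simp [bottomPoint]
    have h1 : {P : ℕ × ℕ | (P.1 + 1, P.2) ∈ insert (bottomPoint (Sum.inl p)) S} =
        {P | (P.1 + 1, P.2) ∈ S} := by
      ext; simp [bottomPoint]
    rw [evalInsert, h0, h1, strandsEnd_union e he, Slice.evalInsert_inl, Category.assoc,
      Category.assoc]
  · have h0 : {q | (0, q) ∈ insert (bottomPoint (Sum.inr p)) S} = {q | (0, q) ∈ S} := by
      ext; simp [bottomPoint]
    -- The top of the lowest slice has height 1, which is height 0 of `d`.
    have h1 : {P : ℕ × ℕ | (P.1 + 1, P.2) ∈ insert (bottomPoint (Sum.inr p)) S} =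
        Prod.mk 0 '' {p} ∪ {P | (P.1 + 1, P.2) ∈ S} := by
      ext ⟨a, b⟩; simp [bottomPoint, eq_comm]
    rw [evalInsert, h0, h1, evalInsert_bottom_union he, Slice.evalInsert_inr, Category.assoc]

/-- Idempotents slide along the arcs of a diagram. -/
lemma Diagram.evalInsert_insert_eq_of_joins (he : ∀ k, e k ≫ e k = e k) {w w' : List (κ × Bool)}
    {d : Diagram κ w w'} {P Q : ℕ × ℕ} (h : d.Joins P Q) (S : Set (ℕ × ℕ)) :
    d.evalInsert e (insert P S) = d.evalInsert e (insert Q S) := by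
  induction h generalizing S with
  | here s d h =>
    rw [evalInsert_cons_union he, evalInsert_cons_union he, s.evalInsert_eq_of_joins e h]
  | there s d h ih =>
    rename_i P Q
    have h0 (P : ℕ × ℕ) : {p | (0, p) ∈ insert (P.1 + 1, P.2) S} = {p | (0, p) ∈ S} := by
      ext; simp
    have h1 (P : ℕ × ℕ) : {R : ℕ × ℕ | (R.1 + 1, R.2) ∈ insert (P.1 + 1, P.2) S} =
        insert P {R | (R.1 + 1, R.2) ∈ S} := by
      ext ⟨a, b⟩; simp [Prod.ext_iff]
    rw [evalInsert, evalInsert, h0, h1, h0, h1, ih]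

lemma Diagram.evalInsert_insert_eq_of_eqvGen (he : ∀ k, e k ≫ e k = e k)
    {w w' : List (κ × Bool)} {d : Diagram κ w w'} {P Q : ℕ × ℕ}
    (h : Relation.EqvGen d.Joins P Q) (S : Set (ℕ × ℕ)) :
    d.evalInsert e (insert P S) = d.evalInsert e (insert Q S) := by
  induction h with
  | rel P Q h => exact evalInsert_insert_eq_of_joins he h S
  | refl P => rfl
  | symm P Q _ ih => exact ih.symm
  | trans P Q R _ _ ih₁ ih₂ => exact ih₁.trans ih₂

/-- Only the points on the component `k` matter if all other endomorphisms are identities. -/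
lemma Diagram.evalInsert_congr {k : κ} (hk : ∀ j, j ≠ k → e j = 𝟙 _) {w w' : List (κ × Bool)}
    (d : Diagram κ w w') {S T : Set (ℕ × ℕ)} (h : ∀ P, d.OnComponent k P → (P ∈ S ↔ P ∈ T)) :
    d.evalInsert e S = d.evalInsert e T := by
  induction d generalizing S T with
  | nil w =>
    exact strandsEnd_congr e k hk w _ _ fun p b hp => h (0, p) ⟨b, hp⟩
  | cons s d ih =>
    rw [evalInsert, evalInsert, strandsEnd_congr e k hk _ {p | (0, p) ∈ S} {p | (0, p) ∈ T}
      fun p b hp => h (0, p) ⟨b, hp⟩,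
      ih (S := {P | (P.1 + 1, P.2) ∈ S}) (T := {P | (P.1 + 1, P.2) ∈ T}) fun P hP => h (P.1 + 1, P.2) hP]

lemma finite_setOf_getElem_eq (k : κ) (w : List (κ × Bool)) :
    {p : ℕ | ∃ b, w[p]? = some (k, b)}.Finite := by
  refine (Set.finite_Iio w.length).subset ?_
  rintro p ⟨b, hb⟩
  exact (List.getElem?_eq_some_iff.1 hb).1

lemma Diagram.finite_onComponent {w w' : List (κ × Bool)} (d : Diagram κ w w') (k : κ) :
    {P | d.OnComponent k P}.Finite := by
  induction d with
  | nil w =>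
    refine ((finite_setOf_getElem_eq k w).image (Prod.mk 0)).subset ?_
    rintro ⟨_ | j, p⟩ h
    · exact ⟨p, h, rfl⟩
    · obtain ⟨b, hb⟩ := h
      simp [strandsAt] at hb
  | @cons w _ _ s d ih =>
    refine (((finite_setOf_getElem_eq k w).image (Prod.mk 0)).union
      (ih.image fun P => (P.1 + 1, P.2))).subset ?_
    rintro ⟨_ | j, p⟩ h
    · exact Or.inl ⟨p, h, rfl⟩
    · exact Or.inr ⟨(j, p), h, rfl⟩

/-- Each new insertion slides to `P`, where the idempotent already present absorbs it. Finiteness of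
`B` permits doing this one point at a time. -/
lemma Diagram.evalInsert_union_of_connected (he : ∀ k, e k ≫ e k = e k) {w w' : List (κ × Bool)}
    {d : Diagram κ w w'} {P : ℕ × ℕ} {S B : Set (ℕ × ℕ)} (hB : B.Finite) (hP : P ∈ S)
    (h : ∀ Q ∈ B, Relation.EqvGen d.Joins P Q) :
    d.evalInsert e (S ∪ B) = d.evalInsert e S := by
  induction B, hB using Set.Finite.induction_on with
  | empty => rw [Set.union_empty]
  | @insert Q B _ _ ih =>
    rw [Set.union_insert, ← evalInsert_insert_eq_of_eqvGen he (h Q (Set.mem_insert _ _)),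
      Set.insert_eq_of_mem (Set.mem_union_left B hP), ih fun R hR => h R (Set.mem_insert_of_mem _ hR)]

/-- On a connected component, an idempotent that is inserted at one point may be inserted at all
points. -/
lemma Diagram.evalInsert_univ (he : ∀ k, e k ≫ e k = e k) {k : κ} (hk : ∀ j, j ≠ k → e j = 𝟙 _)
    {w w' : List (κ × Bool)} {d : Diagram κ w w'} {P : ℕ × ℕ}
    (h : ∀ Q, d.OnComponent k Q → Relation.EqvGen d.Joins P Q) :
    d.evalInsert e Set.univ = d.evalInsert e {P} := by
  rw [← evalInsert_union_of_connected he (d.finite_onComponent k) (Set.mem_singleton P) h]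
  exact d.evalInsert_congr hk fun Q hQ => by simp [hQ]

lemma Diagram.evalInsert_empty {w w' : List (κ × Bool)} (d : Diagram κ w w') :
    d.evalInsert e ∅ = d.eval V := by
  induction d with
  | nil w => simp [evalInsert, Diagram.eval]
  | cons s d ih => simp [evalInsert, Diagram.eval, ih]

end Insertion

/-! ### Retracts of labels -/

section Retract

variable {C : Type u₁} [Category.{v₁} C] [MonoidalCategory C] [PivotalCategory C]
  {κ : Type} {V W : κ → C}

/-- One of the two maps slides around the minimum, meets the other one and cancels by `f ≫ g = 𝟙 X`.
-/
lemma cupMap_tensorHom {X Y : C} {f : X ⟶ Y} {g : Y ⟶ X} (h : f ≫ g = 𝟙 X) (b : Bool) :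
    cupMap Y b ≫ (signedHom g f b ⊗ₘ signedHom g f (!b)) = cupMap X b := by
  rw [tensorHom_def', ← Category.assoc, ← cupMap_whiskerRight, Category.assoc,
    ← comp_whiskerRight, signedHom_comp, h, signedHom_id, id_whiskerRight, Category.comp_id]

lemma tensorHom_capMap {X Y : C} {f : X ⟶ Y} {g : Y ⟶ X} (h : f ≫ g = 𝟙 X) (b : Bool) :
    (signedHom f g b ⊗ₘ signedHom f g (!b)) ≫ capMap Y b = capMap X b := by
  rw [tensorHom_def', Category.assoc, whiskerRight_capMap, ← Category.assoc,
    ← MonoidalCategory.whiskerLeft_comp, signedHom_comp, h, signedHom_id,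
    MonoidalCategory.whiskerLeft_id, Category.id_comp]

lemma strandsHom_comp_eq_id {f : ∀ k, V k ⟶ W k} {g : ∀ k, W k ⟶ V k}
    (h : ∀ k, f k ≫ g k = 𝟙 (V k)) (w : List (κ × Bool)) :
    strandsHom (fun _ => f) (fun _ => g) w ≫ strandsHom (fun _ => g) (fun _ => f) w = 𝟙 _ := by
  simp only [strandsHom_comp, h, strandsHom_id]

variable [BraidedCategory C]

lemma Slice.eval_eq_of_retract {f : ∀ k, V k ⟶ W k} {g : ∀ k, W k ⟶ V k}
    (h : ∀ k, f k ≫ g k = 𝟙 (V k)) {w w' : List (κ × Bool)} (s : Slice κ w w') :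
    s.eval V = strandsHom (fun _ => f) (fun _ => g) w ≫ s.eval W ≫
      strandsHom (fun _ => g) (fun _ => f) w' := by
  induction s with
  | cup k b w =>
    have := cup_natural (strandsHom (fun _ => g) (fun _ => f) w) (cupMap_tensorHom (h k) b)
    refine (Category.id_comp _).symm.trans ?_
    rw [← strandsHom_comp_eq_id h, Category.assoc]
    exact congrArg _ this.symm
  | cap k b w =>
    have := cap_natural (strandsHom (fun _ => f) (fun _ => g) w) (tensorHom_capMap (h k) b)
    refine (Category.comp_id _).symm.trans ?_
    rw [← strandsHom_comp_eq_id h, ← Category.assoc, ← Category.assoc]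
    exact congrArg (· ≫ _) this.symm
  | cross x y o w =>
    have := cross_natural (strandsHom (fun _ => f) (fun _ => g) w)
      (crossMap_natural (signedHom (f x.1) (g x.1) x.2) (signedHom (f y.1) (g y.1) y.2) o)
    refine (Category.comp_id _).symm.trans ?_
    rw [← strandsHom_comp_eq_id h, ← Category.assoc, ← Category.assoc]
    exact congrArg (· ≫ _) this.symm
  | @wire x w w' s ih =>
    have : signed (V x.1) x.2 ◁ s.eval V =
        (signedHom (f x.1) (g x.1) x.2 ⊗ₘ strandsHom (fun _ => f) (fun _ => g) w) ≫
          signed (W x.1) x.2 ◁ s.eval W ≫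
            (signedHom (g x.1) (f x.1) x.2 ⊗ₘ strandsHom (fun _ => g) (fun _ => f) w') := by
      rw [ih, whiskerLeft_comp_tensorHom, tensorHom_comp_tensorHom, signedHom_comp, h,
        signedHom_id, id_tensorHom]
    exact this

/-- Each slice is the slice labelled by `W` between inclusions and projections. Where slices meet, a
projection followed by an inclusion is the idempotent `g k ≫ f k`. -/
lemma Diagram.eval_eq_of_retract {f : ∀ k, V k ⟶ W k} {g : ∀ k, W k ⟶ V k}
    (h : ∀ k, f k ≫ g k = 𝟙 (V k)) {w w' : List (κ × Bool)} (d : Diagram κ w w') :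
    d.eval V = strandsHom (fun _ => f) (fun _ => g) w ≫
      d.evalInsert (fun k => g k ≫ f k) Set.univ ≫ strandsHom (fun _ => g) (fun _ => f) w' := by
  have hE (w : List (κ × Bool)) : strandsEnd (fun k => g k ≫ f k) Set.univ w =
      strandsHom (fun _ => g) (fun _ => f) w ≫ strandsHom (fun _ => f) (fun _ => g) w := by
    rw [strandsEnd_univ, strandsHom_comp]
  have hi := strandsHom_comp_eq_id h
  induction d with
  | nil w =>
    change 𝟙 _ = _ ≫ strandsEnd (fun k => g k ≫ f k) Set.univ w ≫ _
    rw [hE, Category.assoc, hi, Category.comp_id, hi]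
  | @cons w w' w'' s d ih =>
    change s.eval V ≫ d.eval V = _ ≫ (strandsEnd (fun k => g k ≫ f k) Set.univ w ≫ s.eval W ≫
      d.evalInsert (fun k => g k ≫ f k) Set.univ) ≫ _
    have he : ∀ k, (g k ≫ f k) ≫ g k ≫ f k = g k ≫ f k := fun k => by
      rw [Category.assoc, reassoc_of% h k]
    have hd : strandsEnd (fun k => g k ≫ f k) Set.univ w' ≫
        d.evalInsert (fun k => g k ≫ f k) Set.univ =
        d.evalInsert (fun k => g k ≫ f k) Set.univ := by
      rw [← evalInsert_bottom_union he, Set.union_univ]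
    rw [ih, s.eval_eq_of_retract h, ← hd, hE, hE]
    simp only [Category.assoc]
    rw [reassoc_of% hi w', reassoc_of% hi w]

end Retract

/-! ### Additivity -/

section Additive

variable {C : Type u₁} [Category.{v₁} C] [Preadditive C] [MonoidalCategory C]
  [MonoidalPreadditive C]

lemma dualMap_add [LeftRigidCategory C] {X Y : C} (f g : X ⟶ Y) :
    dualMap (f + g) = dualMap f + dualMap g := by
  simp [dualMap, toDual]

lemma signedHom_add [LeftRigidCategory C] {X Y : C} (f f' : X ⟶ Y) (g g' : Y ⟶ X) (b : Bool) :
    signedHom (f + f') (g + g') b = signedHom f g b + signedHom f' g' b := by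
  cases b
  · exact dualMap_add _ _
  · rfl

variable {κ : Type} {V : κ → C}

lemma strandsEnd_singleton_add [LeftRigidCategory C] {e₁ e₂ : ∀ k, V k ⟶ V k} {k : κ}
    (h : e₁ k + e₂ k = 𝟙 (V k)) {w : List (κ × Bool)} {p : ℕ} {b : Bool}
    (hp : w[p]? = some (k, b)) :
    strandsEnd e₁ {p} w + strandsEnd e₂ {p} w = 𝟙 _ := by
  induction w generalizing p with
  | nil => simp at hp
  | cons x w ih =>
    rcases p with _ | p
    · obtain rfl : x = (k, b) := by simpa using hp
      rw [strandsEnd_singleton_zero, strandsEnd_singleton_zero]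
      refine (MonoidalPreadditive.add_whiskerRight _ _).symm.trans ?_
      rw [← signedHom_add, h, signedHom_id]
      exact id_whiskerRight _ _
    · rw [strandsEnd_singleton_succ, strandsEnd_singleton_succ]
      refine (MonoidalPreadditive.whiskerLeft_add _ _).symm.trans ?_
      rw [ih (by simpa using hp)]
      exact MonoidalCategory.whiskerLeft_id _ _

variable [PivotalCategory C] [BraidedCategory C]

/-- Linearity holds because there is only one insertion; with several there would be mixed terms.
This is why the idempotents must first be gathered at one point. -/
lemma Diagram.evalInsert_singleton_add {e₁ e₂ : ∀ k, V k ⟶ V k} {k : κ}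
    (h : e₁ k + e₂ k = 𝟙 (V k)) {w w' : List (κ × Bool)} {d : Diagram κ w w'} {P : ℕ × ℕ}
    (hP : d.OnComponent k P) :
    d.evalInsert e₁ {P} + d.evalInsert e₂ {P} = d.eval V := by
  induction d generalizing P with
  | nil w =>
    rcases P with ⟨_ | j, p⟩
    · obtain ⟨b, hb⟩ := hP
      have h0 : {q : ℕ | (0, q) ∈ ({(0, p)} : Set (ℕ × ℕ))} = {p} := by ext; simp
      rw [evalInsert, evalInsert, h0]
      exact strandsEnd_singleton_add h hb
    · obtain ⟨b, hb⟩ := hP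
      simp [strandsAt] at hb
  | @cons w w' w'' s d ih =>
    rcases P with ⟨_ | j, p⟩
    · obtain ⟨b, hb⟩ := hP
      have h0 : {q : ℕ | (0, q) ∈ ({(0, p)} : Set (ℕ × ℕ))} = {p} := by ext; simp
      have h1 : {Q : ℕ × ℕ | (Q.1 + 1, Q.2) ∈ ({(0, p)} : Set (ℕ × ℕ))} = ∅ := by ext; simp
      rw [evalInsert, evalInsert, h0, h1, evalInsert_empty, evalInsert_empty,
        ← Preadditive.add_comp, strandsEnd_singleton_add (w := w) h hb, Category.id_comp]
      rfl
    · have h0 : {q : ℕ | (0, q) ∈ ({(j + 1, p)} : Set (ℕ × ℕ))} = ∅ := by ext; simp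
      have h1 : {Q : ℕ × ℕ | (Q.1 + 1, Q.2) ∈ ({(j + 1, p)} : Set (ℕ × ℕ))} = {(j, p)} := by
        ext ⟨a, b⟩; simp
      rw [evalInsert, evalInsert, h0, h1, strandsEnd_empty, strandsEnd_empty, Category.id_comp,
        Category.id_comp, ← Preadditive.comp_add, ih (P := (j, p)) hP]
      rfl

end Additive

section Retract

variable {C : Type u₁} [Category.{v₁} C] [MonoidalCategory C] [PivotalCategory C]
  [BraidedCategory C] {κ : Type} {V W : κ → C}

/-- A retract in the label of one component of a link is evaluated by inserting the corresponding
idempotent at one point of the component. -/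
lemma LinkDiagram.eval_eq_evalInsert (L : LinkDiagram κ) {k : κ} {f : ∀ k, V k ⟶ W k}
    {g : ∀ k, W k ⟶ V k} (h : ∀ k, f k ≫ g k = 𝟙 (V k)) (hk : ∀ j, j ≠ k → g j ≫ f j = 𝟙 (W j))
    {P : ℕ × ℕ} (hP : L.diagram.OnComponent k P) :
    L.diagram.eval V = L.diagram.evalInsert (fun k => g k ≫ f k) {P} := by
  have he : ∀ k, (g k ≫ f k) ≫ g k ≫ f k = g k ≫ f k := fun k => by
    rw [Category.assoc, reassoc_of% h k]
  rw [L.diagram.eval_eq_of_retract h, Diagram.evalInsert_univ he hk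
    fun Q hQ => L.component_connected k P Q hP hQ]
  -- The diagram is closed, so the inclusions and projections at its ends are identities.
  exact (Category.id_comp _).trans (Category.comp_id _)

end Retract

/-! ### Functors -/

section Functors

open Functor.LaxMonoidal Functor.OplaxMonoidal Functor.Monoidal

variable {C : Type u₁} [Category.{v₁} C] [MonoidalCategory C]
  {D : Type u₂} [Category.{v₂} D] [MonoidalCategory D]

section Rigid

variable [LeftRigidCategory C] [LeftRigidCategory D] (F : C ⥤ D) [F.Monoidal]

/-- The canonical morphism `F(X*) ⟶ (F X)*` for a downward strand. -/
def signedComparison (X : C) : (b : Bool) → (F.obj (signed X b) ⟶ signed (F.obj X) b)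
  | true => 𝟙 _
  | false => dualComparison F X

variable {κ : Type} (V : κ → C)

/-- The canonical morphism from the image of a tensor product of strands to the tensor product of
the strands labelled by the images. -/
def strandsComparison : (w : List (κ × Bool)) →
    (F.obj (strandsObj V w) ⟶ strandsObj (fun k => F.obj (V k)) w)
  | [] => η F
  | x :: w => δ F (signed (V x.1) x.2) (strandsObj V w) ≫
      (signedComparison F (V x.1) x.2 ⊗ₘ strandsComparison w)

end Rigid

lemma map_associator_hom_comp (F : C ⥤ D) [F.Monoidal] {A B W : C} {A' B' W' : D}
    (f : F.obj A ⟶ A') (g : F.obj B ⟶ B') (t : F.obj W ⟶ W') :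
    F.map (α_ A B W).hom ≫ δ F A (B ⊗ W) ≫ (f ⊗ₘ (δ F B W ≫ (g ⊗ₘ t))) =
      δ F (A ⊗ B) W ≫ ((δ F A B ≫ (f ⊗ₘ g)) ⊗ₘ t) ≫ (α_ A' B' W').hom := by
  rw [← whiskerLeft_comp_tensorHom, ← Functor.OplaxMonoidal.associativity_assoc, ← associator_naturality,
    whiskerRight_comp_tensorHom_assoc]

lemma map_associator_inv_comp (F : C ⥤ D) [F.Monoidal] {A B W : C} {A' B' W' : D}
    (f : F.obj A ⟶ A') (g : F.obj B ⟶ B') (t : F.obj W ⟶ W') :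
    F.map (α_ A B W).inv ≫ δ F (A ⊗ B) W ≫ ((δ F A B ≫ (f ⊗ₘ g)) ⊗ₘ t) =
      (δ F A (B ⊗ W) ≫ (f ⊗ₘ (δ F B W ≫ (g ⊗ₘ t)))) ≫ (α_ A' B' W').inv := by
  rw [← cancel_epi (F.map (α_ A B W).hom), ← cancel_mono (α_ A' B' W').hom]
  simp only [Category.assoc, Iso.inv_hom_id, Category.comp_id, map_associator_hom_comp]
  rw [← F.map_comp_assoc, Iso.hom_inv_id, F.map_id, Category.id_comp]

lemma map_cup (F : C ⥤ D) [F.Monoidal] {A B W : C} {A' B' W' : D} {c : 𝟙_ C ⟶ A ⊗ B}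
    {c' : 𝟙_ D ⟶ A' ⊗ B'} {f : F.obj A ⟶ A'} {g : F.obj B ⟶ B'} (t : F.obj W ⟶ W')
    (h : F.map c ≫ δ F A B ≫ (f ⊗ₘ g) = η F ≫ c') :
    F.map ((λ_ W).inv ≫ c ▷ W ≫ (α_ A B W).hom) ≫ δ F A (B ⊗ W) ≫ (f ⊗ₘ (δ F B W ≫ (g ⊗ₘ t))) =
      t ≫ (λ_ W').inv ≫ c' ▷ W' ≫ (α_ A' B' W').hom := by
  have hη : F.map (λ_ W).inv ≫ δ F (𝟙_ C) W ≫ η F ▷ F.obj W = (λ_ (F.obj W)).inv := by simp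
  rw [F.map_comp, F.map_comp, Category.assoc, Category.assoc, map_associator_hom_comp,
    ← δ_natural_left_assoc, whiskerRight_comp_tensorHom_assoc, h, leftUnitor_inv_naturality_assoc,
    whisker_exchange_assoc, ← hη, MonoidalCategory.tensorHom_def]
  simp only [comp_whiskerRight, Category.assoc]

lemma map_cap (F : C ⥤ D) [F.Monoidal] {A B W : C} {A' B' W' : D} {c : A ⊗ B ⟶ 𝟙_ C}
    {c' : A' ⊗ B' ⟶ 𝟙_ D} {f : F.obj A ⟶ A'} {g : F.obj B ⟶ B'} (t : F.obj W ⟶ W')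
    (h : F.map c ≫ η F = δ F A B ≫ (f ⊗ₘ g) ≫ c') :
    F.map ((α_ A B W).inv ≫ c ▷ W ≫ (λ_ W).hom) ≫ t =
      (δ F A (B ⊗ W) ≫ (f ⊗ₘ (δ F B W ≫ (g ⊗ₘ t)))) ≫
        (α_ A' B' W').inv ≫ c' ▷ W' ≫ (λ_ W').hom := by
  have hη : F.map (λ_ W).hom = δ F (𝟙_ C) W ≫ η F ▷ F.obj W ≫ (λ_ (F.obj W)).hom := by simp
  rw [← Category.assoc _ (α_ A' B' W').inv, ← map_associator_inv_comp]
  simp only [Category.assoc, F.map_comp]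
  rw [tensorHom_comp_whiskerRight_assoc, Category.assoc, ← h, hη, Category.assoc, Category.assoc, ← leftUnitor_naturality,
    ← δ_natural_left_assoc, MonoidalCategory.tensorHom_def]
  simp only [Category.assoc, comp_whiskerRight]

lemma map_cross (F : C ⥤ D) [F.Monoidal] {A B W : C} {A' B' W' : D} {c : A ⊗ B ⟶ B ⊗ A}
    {c' : A' ⊗ B' ⟶ B' ⊗ A'} {f : F.obj A ⟶ A'} {g : F.obj B ⟶ B'} (t : F.obj W ⟶ W')
    (h : F.map c ≫ δ F B A ≫ (g ⊗ₘ f) = δ F A B ≫ (f ⊗ₘ g) ≫ c') :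
    F.map ((α_ A B W).inv ≫ c ▷ W ≫ (α_ B A W).hom) ≫
        δ F B (A ⊗ W) ≫ (g ⊗ₘ (δ F A W ≫ (f ⊗ₘ t))) =
      (δ F A (B ⊗ W) ≫ (f ⊗ₘ (δ F B W ≫ (g ⊗ₘ t)))) ≫
        (α_ A' B' W').inv ≫ c' ▷ W' ≫ (α_ B' A' W').hom := by
  rw [← Category.assoc _ (α_ A' B' W').inv, ← map_associator_inv_comp]
  simp only [Category.assoc, F.map_comp]
  rw [tensorHom_comp_whiskerRight_assoc, Category.assoc, ← h, map_associator_hom_comp,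
    ← δ_natural_left_assoc, whiskerRight_comp_tensorHom_assoc]

lemma map_crossMap [BraidedCategory C] [BraidedCategory D] (F : C ⥤ D) [F.Braided] {A B : C}
    {A' B' : D} (f : F.obj A ⟶ A') (g : F.obj B ⟶ B') (o : Bool) :
    F.map (crossMap A B o) ≫ δ F B A ≫ (g ⊗ₘ f) = δ F A B ≫ (f ⊗ₘ g) ≫ crossMap A' B' o := by
  rw [crossMap_natural, ← Category.assoc, ← Category.assoc]
  congr 1
  cases o
  · change F.map (β_ B A).inv ≫ δ F B A = δ F A B ≫ (β_ (F.obj B) (F.obj A)).inv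
    rw [← cancel_mono (β_ (F.obj B) (F.obj A)).hom, ← cancel_epi (F.map (β_ B A).hom)]
    simp only [Category.assoc, Iso.inv_hom_id, Category.comp_id]
    rw [← F.map_comp_assoc, Iso.hom_inv_id, F.map_id, Category.id_comp, F.map_braiding]
    simp
  · change F.map (β_ A B).hom ≫ δ F B A = δ F A B ≫ (β_ (F.obj A) (F.obj B)).hom
    rw [F.map_braiding]
    simp

section Pivotal

variable [PivotalCategory C] [PivotalCategory D]

lemma IsPivotal.map_cupMap {F : C ⥤ D} [F.Monoidal] (hF : IsPivotal F) (X : C) (b : Bool) :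
    F.map (cupMap X b) ≫ δ F _ _ ≫ (signedComparison F X b ⊗ₘ signedComparison F X (!b)) =
      η F ≫ cupMap (F.obj X) b := by
  cases b
  · refine Eq.trans ?_ (map_coev_dualComparison F X)
    exact congrArg _ (congrArg _ (tensorHom_id _ _))
  · refine Eq.trans ?_ (hF.map_coevTilde_dualComparison X)
    exact congrArg _ (congrArg _ (id_tensorHom _ _))

lemma IsPivotal.map_capMap {F : C ⥤ D} [F.Monoidal] (hF : IsPivotal F) (X : C) (b : Bool) :
    F.map (capMap X b) ≫ η F =
      δ F _ _ ≫ (signedComparison F X b ⊗ₘ signedComparison F X (!b)) ≫ capMap (F.obj X) b := by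
  cases b
  · refine (hF.whiskerRight_dualComparison_evTilde X).symm.trans ?_
    exact congrArg _ (congrArg (· ≫ _) (tensorHom_id _ _).symm)
  · refine (whiskerLeft_dualComparison_ev F X).symm.trans ?_
    exact congrArg _ (congrArg (· ≫ _) (id_tensorHom _ _).symm)

variable [BraidedCategory C] [BraidedCategory D] {F : C ⥤ D} [F.Braided] {κ : Type} (V : κ → C)

/-- Minima and maxima use pivotality, crossings use the braiding. Stacking these squares gives the
result for diagrams. -/
lemma Slice.map_eval (hF : IsPivotal F) {w w' : List (κ × Bool)} (s : Slice κ w w') :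
    F.map (s.eval V) ≫ strandsComparison F V w' =
      strandsComparison F V w ≫ s.eval (fun k => F.obj (V k)) := by
  induction s with
  | cup k b w => exact map_cup F _ (hF.map_cupMap (V k) b)
  | cap k b w => exact map_cap F _ (hF.map_capMap (V k) b)
  | cross x y o w => exact map_cross F _ (map_crossMap F _ _ o)
  | @wire x w w' s ih =>
    have : F.map (signed (V x.1) x.2 ◁ s.eval V) ≫ δ F _ _ ≫
        (signedComparison F (V x.1) x.2 ⊗ₘ strandsComparison F V w') =
        (δ F _ _ ≫ (signedComparison F (V x.1) x.2 ⊗ₘ strandsComparison F V w)) ≫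
          signed (F.obj (V x.1)) x.2 ◁ s.eval (fun k => F.obj (V k)) := by
      rw [← δ_natural_right_assoc, whiskerLeft_comp_tensorHom, ih, Category.assoc,
        tensorHom_comp_whiskerLeft]
    exact this

lemma Diagram.map_eval (hF : IsPivotal F) {w w' : List (κ × Bool)} (d : Diagram κ w w') :
    F.map (d.eval V) ≫ strandsComparison F V w' =
      strandsComparison F V w ≫ d.eval (fun k => F.obj (V k)) := by
  induction d with
  | nil w =>
    change F.map (𝟙 _) ≫ _ = _ ≫ 𝟙 _
    rw [F.map_id, Category.id_comp, Category.comp_id]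
  | cons s d ih =>
    rw [Diagram.eval, Diagram.eval, F.map_comp, Category.assoc, ih, ← Category.assoc,
      s.map_eval V hF, Category.assoc]

end Pivotal

end Functors

/-! ### Linear functions of colours -/

section FusionAlgebra

lemma mapColour_single {C : Type u₁} [Category.{v₁} C] {D : Type u₂} [Category.{v₂} D] (F : C ⥤ D) (X : C) (c : ℂ) :
    mapColour F (Finsupp.single X c) = Finsupp.single (F.obj X) c :=
  Finsupp.mapDomain_single

variable {C : Type u₁} [Category.{v₁} C] [Preadditive C]

/-- The universal property of the fusion algebra, through which functors, dimensions, transparent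
parts and link evaluations descend. -/
lemma map_eq_of_toFusionAlgebra_eq {E : Type*} [AddCommGroup E] [Module ℂ E]
    (φ : Colour C →ₗ[ℂ] E)
    (hiso : ∀ X Y : C, Nonempty (X ≅ Y) → φ (Finsupp.single X 1) = φ (Finsupp.single Y 1))
    (hadd : ∀ (X Y : C) (b : BinaryBicone X Y), Nonempty b.IsBilimit →
      φ (Finsupp.single b.pt 1) = φ (Finsupp.single X 1) + φ (Finsupp.single Y 1))
    {x y : Colour C} (h : toFusionAlgebra x = toFusionAlgebra y) : φ x = φ y := by
  have hle : fusionRelations C ≤ LinearMap.ker φ := by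
    refine Submodule.span_le.2 ?_
    rintro _ (⟨X, Y, e, rfl⟩ | ⟨X, Y, b, hb, rfl⟩)
    · simp [hiso X Y e]
    · simp [hadd X Y b hb]
  have hxy : x - y ∈ fusionRelations C := (Submodule.Quotient.eq _).1 h
  have := hle hxy
  rwa [LinearMap.mem_ker, map_sub, sub_eq_zero] at this

lemma toFusionAlgebra_single_eq_of_iso {X Y : C} (e : X ≅ Y) :
    toFusionAlgebra (Finsupp.single X (1 : ℂ)) = toFusionAlgebra (Finsupp.single Y 1) :=
  (Submodule.Quotient.eq _).2 (Submodule.subset_span (Or.inl ⟨X, Y, ⟨e⟩, rfl⟩))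

lemma toFusionAlgebra_single_biprod {X Y : C} (b : BinaryBicone X Y) (hb : b.IsBilimit) :
    toFusionAlgebra (Finsupp.single b.pt (1 : ℂ)) =
      toFusionAlgebra (Finsupp.single X 1) + toFusionAlgebra (Finsupp.single Y 1) := by
  rw [← map_add]
  refine (Submodule.Quotient.eq _).2 (Submodule.subset_span (Or.inr ⟨X, Y, b, ⟨hb⟩, ?_⟩))
  rw [sub_sub]

variable {D : Type u₂} [Category.{v₂} D] [Preadditive D]

/-- Additive functors act on the fusion algebra. -/
lemma toFusionAlgebra_mapColour_eq (F : C ⥤ D) [F.Additive] {x y : Colour C}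
    (h : toFusionAlgebra x = toFusionAlgebra y) :
    toFusionAlgebra (mapColour F x) = toFusionAlgebra (mapColour F y) := by
  refine map_eq_of_toFusionAlgebra_eq (toFusionAlgebra ∘ₗ mapColour F) ?_ ?_ h
  · rintro X Y ⟨e⟩
    simpa [mapColour_single] using toFusionAlgebra_single_eq_of_iso (F.mapIso e)
  · rintro X Y b ⟨hb⟩
    have : (F.mapBinaryBicone b).fst ≫ (F.mapBinaryBicone b).inl +
        (F.mapBinaryBicone b).snd ≫ (F.mapBinaryBicone b).inr =
        𝟙 (F.mapBinaryBicone b).pt := by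
      have := congrArg F.map (IsBilimit.binary_total hb)
      rw [F.map_add, F.map_comp, F.map_comp, F.map_id] at this
      exact this
    simpa [mapColour_single] using
      toFusionAlgebra_single_biprod (F.mapBinaryBicone b) (isBinaryBilimitOfTotal _ this)

end FusionAlgebra

/-! ### Scalars and dimensions -/

section Scalar

variable {C : Type u₁} [Category.{v₁} C] [Preadditive C] [Linear ℂ C] [MonoidalCategory C]

section

variable [FusionCategory C]

lemma scalar_smul_id (f : 𝟙_ C ⟶ 𝟙_ C) : scalar f • 𝟙 (𝟙_ C) = f :=
  (Equiv.ofBijective _ (FusionCategory.unit_simple (C := C))).apply_symm_apply f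

lemma scalar_eq_iff {f : 𝟙_ C ⟶ 𝟙_ C} {c : ℂ} : scalar f = c ↔ f = c • 𝟙 (𝟙_ C) := by
  constructor
  · rintro rfl; exact (scalar_smul_id f).symm
  · intro h
    refine (FusionCategory.unit_simple (C := C)).1 ?_
    simpa [h] using scalar_smul_id f

@[simp]
lemma scalar_add (f g : 𝟙_ C ⟶ 𝟙_ C) : scalar (f + g) = scalar f + scalar g := by
  rw [scalar_eq_iff, add_smul, scalar_smul_id, scalar_smul_id]

@[simp]
lemma scalar_smul (c : ℂ) (f : 𝟙_ C ⟶ 𝟙_ C) : scalar (c • f) = c * scalar f := by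
  rw [scalar_eq_iff, mul_smul, scalar_smul_id]

@[simp]
lemma scalar_id : scalar (𝟙 (𝟙_ C)) = 1 := by
  rw [scalar_eq_iff, one_smul]

end

lemma scalar_eq_of_map {D : Type u₂} [Category.{v₂} D] [Preadditive D] [Linear ℂ D]
    [MonoidalCategory D] [FusionCategory C] [FusionCategory D] (F : C ⥤ D) [F.Additive]
    [F.Linear ℂ] [F.Monoidal] {f : 𝟙_ C ⟶ 𝟙_ C} {g : 𝟙_ D ⟶ 𝟙_ D}
    (h : F.map f ≫ Functor.OplaxMonoidal.η F = Functor.OplaxMonoidal.η F ≫ g) :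
    scalar f = scalar g := by
  symm
  rw [scalar_eq_iff, ← cancel_epi (Functor.OplaxMonoidal.η F), ← h]
  conv_lhs => rw [← scalar_smul_id f]
  simp [F.map_smul]

variable [SphericalFusionCategory C]

lemma trR_add {X : C} (f g : X ⟶ X) : trR (f + g) = trR f + trR g := by
  simp [trR]

lemma trR_smul {X : C} (c : ℂ) (f : X ⟶ X) : trR (c • f) = c • trR f := by
  simp [trR]

lemma dim_eq_of_iso {X Y : C} (e : X ≅ Y) : dim X = dim Y := by
  rw [dim, dim, ← e.hom_inv_id, trR_comp_comm, e.inv_hom_id]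

/-- The identity is the sum of two idempotents; by cyclicity their traces are those of the
identities of the summands. -/
lemma dim_biprod {X Y : C} (b : BinaryBicone X Y) (hb : b.IsBilimit) :
    dim b.pt = dim X + dim Y := by
  rw [dim, ← (IsBilimit.binary_total hb), trR_add, scalar_add, trR_comp_comm, trR_comp_comm b.snd,
    b.inl_fst, b.inr_snd]
  rfl

lemma dim_dual (X : C) : dim (dual X) = dim X := by
  rw [dim, trR_id_dual, SphericalFusionCategory.spherical, dim]

lemma dim_tensor (X Y : C) : dim (X ⊗ Y) = dim X * dim Y := by
  have h : (𝟙 X ⊗≫ X ◁ trR (𝟙 Y) ⊗≫ 𝟙 X : X ⟶ X) = dim Y • 𝟙 X := by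
    rw [← scalar_smul_id (trR (𝟙 Y))]
    simp [monoidalComp, dim]
  rw [dim, trR_id_tensor, h]
  change scalar (trR (dim Y • 𝟙 X)) = _
  rw [trR_smul, scalar_smul, mul_comm]
  rfl

variable {D : Type u₂} [Category.{v₂} D] [Preadditive D] [Linear ℂ D]
  [MonoidalCategory D] [SphericalFusionCategory D]

lemma IsPivotal.dim_obj {F : C ⥤ D} [F.Additive] [F.Linear ℂ] [F.Monoidal] (hF : IsPivotal F)
    (X : C) : dim (F.obj X) = dim X :=
  (scalar_eq_of_map F (hF.map_trR_id X)).symm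

/-- The dimension of colours as a linear map. -/
lemma colourDim_eq (x : Colour C) : colourDim x = Finsupp.linearCombination ℂ dim x := rfl

lemma colourDim_smul (c : ℂ) (x : Colour C) : colourDim (c • x) = c * colourDim x := by
  simp [colourDim_eq]

lemma colourDim_eq_of_toFusionAlgebra_eq {x y : Colour C}
    (h : toFusionAlgebra x = toFusionAlgebra y) : colourDim x = colourDim y := by
  rw [colourDim_eq, colourDim_eq]
  refine map_eq_of_toFusionAlgebra_eq _ ?_ ?_ h
  · rintro X Y ⟨e⟩
    simpa using dim_eq_of_iso e
  · rintro X Y b ⟨hb⟩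
    simpa using dim_biprod b hb

lemma IsPivotal.colourDim_mapColour {F : C ⥤ D} [F.Additive] [F.Linear ℂ] [F.Monoidal]
    (hF : IsPivotal F) (x : Colour C) : colourDim (mapColour F x) = colourDim x := by
  rw [colourDim_eq, colourDim_eq, mapColour, Finsupp.lmapDomain_apply,
    Finsupp.linearCombination_mapDomain]
  congr 2
  ext X
  exact hF.dim_obj X

end Scalar

/-! ### Transparent parts -/

section Transparent

variable {C : Type u₁} [Category.{v₁} C] [Preadditive C] [Linear ℂ C]

lemma finrank_hom_eq_of_iso (Z : C) {X Y : C} (e : X ≅ Y) :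
    Module.finrank ℂ (Z ⟶ X) = Module.finrank ℂ (Z ⟶ Y) :=
  LinearEquiv.finrank_eq (Linear.homCongr ℂ (Iso.refl Z) e)

lemma finrank_hom_biprod [MonoidalCategory C] [FusionCategory C] (Z : C) {X Y : C}
    (b : BinaryBicone X Y) (hb : b.IsBilimit) :
    Module.finrank ℂ (Z ⟶ b.pt) = Module.finrank ℂ (Z ⟶ X) + Module.finrank ℂ (Z ⟶ Y) := by
  have := FusionCategory.finiteDimensional_hom (C := C)
  rw [← Module.finrank_prod]
  refine LinearEquiv.finrank_eq (LinearEquiv.ofLinearMap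
    ((Linear.rightComp ℂ Z b.fst).prod (Linear.rightComp ℂ Z b.snd))
    ((Linear.rightComp ℂ Z b.inl).coprod (Linear.rightComp ℂ Z b.inr)) ?_ ?_)
  · ext f <;> simp
  · ext f
    simp [← Preadditive.comp_add, (IsBilimit.binary_total hb)]

variable [MonoidalCategory C] [RibbonFusionCategory C]

lemma transparentPart_eq (x : Colour C) :
    transparentPart x = Finsupp.linearCombination ℂ objTransparentPart x := rfl

lemma transparentPart_smul (c : ℂ) (x : Colour C) :
    transparentPart (c • x) = c • transparentPart x := by
  simp [transparentPart_eq]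

/-- The result is an equality of formal combinations, since transparent parts are expanded in the
fixed representatives `irr i`. Their coefficients are multiplicities, which are additive. -/
lemma transparentPart_eq_of_toFusionAlgebra_eq {x y : Colour C}
    (h : toFusionAlgebra x = toFusionAlgebra y) : transparentPart x = transparentPart y := by
  rw [transparentPart_eq, transparentPart_eq]
  refine map_eq_of_toFusionAlgebra_eq _ ?_ ?_ h
  · rintro X Y ⟨e⟩
    simp [objTransparentPart, finrank_hom_eq_of_iso _ e]
  · rintro X Y b ⟨hb⟩
    simp only [Finsupp.linearCombination_single, one_smul, objTransparentPart]
    rw [← Finset.sum_add_distrib]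
    refine Finset.sum_congr rfl fun i _ => ?_
    split_ifs
    · rw [finrank_hom_biprod _ b hb, Nat.cast_add, Finsupp.single_add]
    · rw [add_zero]

end Transparent

/-! ### Evaluation of links -/

section LinkEval

lemma strandsEnd_id {C : Type u₁} [Category.{v₁} C] [MonoidalCategory C] [LeftRigidCategory C]
    {κ : Type} {V : κ → C} (S : Set ℕ) (w : List (κ × Bool)) :
    strandsEnd (fun k => 𝟙 (V k)) S w = 𝟙 _ := by
  simp [strandsEnd, strandsHom_id]

lemma Diagram.evalInsert_id {C : Type u₁} [Category.{v₁} C] [MonoidalCategory C]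
    [PivotalCategory C] [BraidedCategory C] {κ : Type} {V : κ → C} {w w' : List (κ × Bool)}
    (d : Diagram κ w w') (S : Set (ℕ × ℕ)) :
    d.evalInsert (fun k => 𝟙 (V k)) S = d.eval V := by
  induction d generalizing S with
  | nil w => exact strandsEnd_id _ w
  | cons s d ih => rw [evalInsert, strandsEnd_id, ih, Category.id_comp, Diagram.eval]

variable {C : Type u₁} [Category.{v₁} C] [Preadditive C] [Linear ℂ C] [MonoidalCategory C]
  [RibbonFusionCategory C] {κ : Type} (L : LinkDiagram κ)

lemma LinkDiagram.eval_eq_of_iso {V W : κ → C} (e : ∀ k, V k ≅ W k) : L.eval V = L.eval W := by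
  rw [eval, eval, L.diagram.eval_eq_of_retract fun k => (e k).hom_inv_id]
  simp only [Iso.inv_hom_id, Diagram.evalInsert_id]
  exact congrArg scalar ((Category.id_comp _).trans (Category.comp_id _))

/-- The evaluation of a link is additive in the label of each component. -/
lemma LinkDiagram.eval_update_biprod [DecidableEq κ] (V : κ → C) (k : κ) {X Y : C}
    (b : BinaryBicone X Y) (hb : b.IsBilimit) :
    L.eval (Function.update V k b.pt) =
      L.eval (Function.update V k X) + L.eval (Function.update V k Y) := by
  -- Extends a retract at `k` by identities to a retract of the whole family of labels. The
  -- `eqToHom`s only account for `Function.update`.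
  have key : ∀ {Z : C} (f : Z ⟶ b.pt) (g : b.pt ⟶ Z), f ≫ g = 𝟙 Z →
      ∃ (f' : ∀ j, Function.update V k Z j ⟶ Function.update V k b.pt j)
        (g' : ∀ j, Function.update V k b.pt j ⟶ Function.update V k Z j),
        (∀ j, f' j ≫ g' j = 𝟙 _) ∧ (∀ j, j ≠ k → g' j ≫ f' j = 𝟙 _) ∧
        g' k ≫ f' k = eqToHom (by simp) ≫ (g ≫ f) ≫ eqToHom (by simp) := by
    intro Z f g h
    have hj : ∀ {j}, j ≠ k → ∀ W : C, Function.update V k W j = V j := fun hj W => by simp [hj]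
    refine ⟨fun j => if h : j = k then eqToHom (by simp [h]) ≫ f ≫ eqToHom (by simp [h])
        else eqToHom (by simp [h]),
      fun j => if h : j = k then eqToHom (by simp [h]) ≫ g ≫ eqToHom (by simp [h])
        else eqToHom (by simp [h]), fun j => ?_, fun j hj => ?_, ?_⟩
    · by_cases hj : j = k
      · simp [hj, reassoc_of% h]
      · simp [hj]
    · simp [hj]
    · simp
  obtain ⟨f₁, g₁, h₁, h₁', e₁⟩ := key b.inl b.fst b.inl_fst
  obtain ⟨f₂, g₂, h₂, h₂', e₂⟩ := key b.inr b.snd b.inr_snd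
  obtain ⟨P, hP⟩ := L.component_nonempty k
  have hadd : g₁ k ≫ f₁ k + g₂ k ≫ f₂ k = 𝟙 _ := by
    rw [e₁, e₂, ← Preadditive.comp_add, ← Preadditive.add_comp, IsBilimit.binary_total hb]
    simp
  rw [eval, eval, eval, L.eval_eq_evalInsert h₁ h₁' hP, L.eval_eq_evalInsert h₂ h₂' hP]
  refine Eq.trans ?_ (scalar_add (C := C) _ _)
  exact congrArg scalar (Diagram.evalInsert_singleton_add
    (e₁ := fun k => g₁ k ≫ f₁ k) (e₂ := fun k => g₂ k ≫ f₂ k) hadd hP).symm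

lemma LinkDiagram.eval_map {D : Type u₂} [Category.{v₂} D] [Preadditive D] [Linear ℂ D]
    [MonoidalCategory D] [RibbonFusionCategory D] (F : C ⥤ D) [F.Additive] [F.Linear ℂ]
    [F.Braided] (hF : IsPivotal F) (V : κ → C) :
    L.eval (fun k => F.obj (V k)) = L.eval V :=
  (scalar_eq_of_map F (L.diagram.map_eval V hF)).symm

end LinkEval

/-! ### Multilinear extension -/

section Multilinear

variable {κ : Type} [Fintype κ] [DecidableEq κ] {α : Type*} (E : (κ → α) → ℂ)

/-- The value of the multilinear extension of a function of families of labels. -/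
noncomputable def multiSum (z : κ → α →₀ ℂ) : ℂ :=
  ∑ f ∈ Fintype.piFinset (fun k => (z k).support), (∏ k, z k (f k)) * E f

/-- Lets sums for colours with different supports be compared over a common index set. -/
lemma multiSum_eq_of_subset (z : κ → α →₀ ℂ) {s : κ → Finset α} (hs : ∀ k, (z k).support ⊆ s k) :
    multiSum E z = ∑ f ∈ Fintype.piFinset s, (∏ k, z k (f k)) * E f := by
  refine Finset.sum_subset (Fintype.piFinset_subset _ _ hs) fun f _ hf => ?_
  obtain ⟨k, hk⟩ : ∃ k, f k ∉ (z k).support := by simpa [Fintype.mem_piFinset] using hf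
  have h0 : ∏ k, z k (f k) = 0 :=
    Finset.prod_eq_zero (Finset.mem_univ k) (Finsupp.notMem_support_iff.1 hk)
  rw [h0, zero_mul]

/-- The multilinear extension of a function of families of labels to formal linear combinations of
labels. -/
noncomputable def multilinearExtension : MultilinearMap ℂ (fun _ : κ => α →₀ ℂ) ℂ :=
  MultilinearMap.mk' (multiSum E)
    (fun z i x y => by
      classical
      let s : κ → Finset α := fun k => (z k).support ∪ x.support ∪ y.support
      have hs (u : α →₀ ℂ) (hu : u.support ⊆ x.support ∪ y.support) (k : κ) :
          (Function.update z i u k).support ⊆ s k := by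
        rcases eq_or_ne k i with rfl | hk
        · rw [Function.update_self]
          exact hu.trans (by simp [s, Finset.union_assoc])
        · rw [Function.update_of_ne hk]
          simp [s, Finset.union_assoc]
      rw [multiSum_eq_of_subset E _ (hs _ Finsupp.support_add),
        multiSum_eq_of_subset E _ (hs x Finset.subset_union_left),
        multiSum_eq_of_subset E _ (hs y Finset.subset_union_right), ← Finset.sum_add_distrib]
      refine Finset.sum_congr rfl fun f _ => ?_
      rw [← add_mul]
      congr 1
      -- For a fixed family of labels, the product of coefficients is multilinear in the colours.
      exact ((MultilinearMap.mkPiAlgebra ℂ κ ℂ).compLinearMap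
        fun k => Finsupp.lapply (f k)).map_update_add z i x y)
    (fun z i c x => by
      classical
      let s : κ → Finset α := fun k => (z k).support ∪ x.support
      have hs (u : α →₀ ℂ) (hu : u.support ⊆ x.support) (k : κ) :
          (Function.update z i u k).support ⊆ s k := by
        rcases eq_or_ne k i with rfl | hk
        · rw [Function.update_self]
          exact hu.trans (by simp [s])
        · rw [Function.update_of_ne hk]
          simp [s]
      rw [multiSum_eq_of_subset E _ (hs _ Finsupp.support_smul),
        multiSum_eq_of_subset E _ (hs x subset_rfl), Finset.smul_sum]
      refine Finset.sum_congr rfl fun f _ => ?_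
      rw [smul_eq_mul, ← mul_assoc]
      congr 1
      exact ((MultilinearMap.mkPiAlgebra ℂ κ ℂ).compLinearMap
        fun k => Finsupp.lapply (f k)).map_update_smul z i c x)

lemma multilinearExtension_apply (z : κ → α →₀ ℂ) : multilinearExtension E z = multiSum E z := rfl

lemma multilinearExtension_single (v : κ → α) :
    multilinearExtension E (fun k => Finsupp.single (v k) 1) = E v := by
  rw [multilinearExtension_apply, multiSum_eq_of_subset E _ (s := fun k => {v k})
    fun k => Finsupp.support_single_subset, Fintype.piFinset_singleton]
  simp

/-- A multilinear function on formal linear combinations of labels vanishes if an argument is an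
element that is annihilated whenever the other arguments are labels. -/
lemma map_update_eq_zero (M : MultilinearMap ℂ (fun _ : κ => α →₀ ℂ) ℂ) (k : κ) (u : α →₀ ℂ)
    (h : ∀ v : κ → α, M (Function.update (fun j => Finsupp.single (v j) 1) k u) = 0)
    (z : κ → α →₀ ℂ) : M (Function.update z k u) = 0 := by
  by_cases hα : Nonempty α
  swap
  · have : IsEmpty α := not_nonempty_iff.1 hα
    rw [Subsingleton.elim u 0]
    exact M.map_update_zero z k
  obtain ⟨a⟩ := hα
  -- `T` sends every basis vector to `u`. So `M` precomposed with `T` in slot `k` vanishes on basis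
  -- families, hence everywhere, and a basis vector in slot `k` recovers the claim.
  let T : (α →₀ ℂ) →ₗ[ℂ] (α →₀ ℂ) :=
    (LinearMap.toSpanSingleton ℂ (α →₀ ℂ) u) ∘ₗ Finsupp.linearCombination ℂ fun _ => (1 : ℂ)
  let g : κ → (α →₀ ℂ) →ₗ[ℂ] (α →₀ ℂ) := Function.update (fun _ => LinearMap.id) k T
  have h0 : M.compLinearMap g = 0 := by
    refine Module.Basis.ext_multilinear (fun _ => Finsupp.basisSingleOne) fun v => ?_
    rw [MultilinearMap.compLinearMap_apply, zero_apply, ← h v]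
    congr 1
    ext1 j
    rcases eq_or_ne j k with rfl | hj
    · simp [g, T]
    · simp [g, hj]
  have := congrArg (fun N => N (Function.update z k (Finsupp.single a 1))) h0
  rw [zero_apply, MultilinearMap.compLinearMap_apply] at this
  rw [← this]
  congr 1
  ext1 j
  rcases eq_or_ne j k with rfl | hj
  · simp [g, T]
  · simp [g, hj]

end Multilinear

/-! ### Links labelled by classes in the fusion algebra -/

section LinkMultilinear

variable {C : Type u₁} [Category.{v₁} C] [Preadditive C] [Linear ℂ C] [MonoidalCategory C]
  [RibbonFusionCategory C]

/-- The evaluation of a link labelled by colours only depends on the classes of the colours in the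
fusion algebra. -/
lemma LinkDiagram.multilinearExtension_eval_congr {κ : Type} [Fintype κ] [DecidableEq κ]
    (L : LinkDiagram κ) {z z' : κ → Colour C}
    (h : ∀ k, toFusionAlgebra (z k) = toFusionAlgebra (z' k)) :
    multilinearExtension (L.eval (C := C)) z = multilinearExtension (L.eval (C := C)) z' := by
  set M := multilinearExtension (L.eval (C := C)) with hM
  have hsingle (v : κ → C) (k : κ) (X : C) :
      M (Function.update (fun j => Finsupp.single (v j) 1) k (Finsupp.single X 1)) =
        L.eval (Function.update v k X) := by
    rw [hM, ← multilinearExtension_single L.eval]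
    congr 1
    ext1 j
    rcases eq_or_ne j k with rfl | hj
    · simp
    · simp [hj]
  have step (z : κ → Colour C) (k : κ) {x y : Colour C}
      (hxy : toFusionAlgebra x = toFusionAlgebra y) :
      M (Function.update z k x) = M (Function.update z k y) := by
    refine map_eq_of_toFusionAlgebra_eq (M.toLinearMap z k) ?_ ?_ hxy
    · rintro X Y ⟨e⟩
      rw [← sub_eq_zero, ← map_sub]
      refine map_update_eq_zero M k _ (fun v => ?_) z
      rw [M.map_update_sub, hsingle, hsingle, sub_eq_zero]
      refine L.eval_eq_of_iso fun j => ?_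
      exact if hj : j = k then eqToIso (by simp [hj]) ≪≫ e ≪≫ eqToIso (by simp [hj])
        else eqToIso (by simp [hj])
    · rintro X Y b ⟨hb⟩
      rw [← sub_eq_zero, ← map_add, ← map_sub]
      refine map_update_eq_zero M k _ (fun v => ?_) z
      rw [M.map_update_sub, M.map_update_add, hsingle, hsingle, hsingle,
        L.eval_update_biprod v k b hb, sub_self]
  -- The labels are exchanged one component at a time.
  have main (s : Finset κ) : M (s.piecewise z z') = M z' := by
    induction s using Finset.induction_on with
    | empty => simp
    | insert k s hk ih =>
      rw [Finset.piecewise_insert, step _ k (h k), ← ih]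
      congr 1
      ext1 j
      rcases eq_or_ne j k with rfl | hj
      · simp [hk]
      · simp [hj]
  simpa using main Finset.univ

lemma DottedLinkDiagram.eval_eq (L : DottedLinkDiagram) (x y : Colour C) :
    L.eval x y = multilinearExtension (L.link.eval (C := C))
      (Sum.elim (fun _ => x) (fun _ => y)) := by
  rw [multilinearExtension_apply, multiSum, DottedLinkDiagram.eval, ← Finset.sum_product']
  refine Finset.sum_equiv (Equiv.sumArrowEquivProdArrow _ _ _).symm ?_ ?_
  · rintro ⟨f, g⟩
    simp [Fintype.mem_piFinset, Equiv.sumArrowEquivProdArrow]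
  · rintro ⟨f, g⟩ _
    simp [Fintype.prod_sum_type, Equiv.sumArrowEquivProdArrow]

lemma DottedLinkDiagram.eval_of_smul (L : DottedLinkDiagram) {x x' y y' : Colour C} {a b : ℂ}
    (hx : toFusionAlgebra x = a • toFusionAlgebra x')
    (hy : toFusionAlgebra y = b • toFusionAlgebra y') :
    L.eval x y = a ^ L.h₁ * b ^ L.h₂ * L.eval x' y' := by
  rw [eval_eq, eval_eq, L.link.multilinearExtension_eval_congr (z' := fun k =>
    (Sum.elim (fun _ => a) (fun _ => b) k : ℂ) • Sum.elim (fun _ => x') (fun _ => y') k)]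
  · rw [MultilinearMap.map_smul_univ]
    simp [Fintype.prod_sum_type]
  · rintro (k | k)
    · simpa using hx
    · simpa using hy

lemma DottedLinkDiagram.eval_mapColour {D : Type u₂} [Category.{v₂} D] [Preadditive D]
    [Linear ℂ D] [MonoidalCategory D] [RibbonFusionCategory D] (F : C ⥤ D) [F.Additive]
    [F.Linear ℂ] [F.Braided] (hF : IsPivotal F) (L : DottedLinkDiagram) (x y : Colour C) :
    L.eval (mapColour F x) (mapColour F y) = L.eval x y := by
  rw [eval_eq, eval_eq]
  have : (multilinearExtension (L.link.eval (C := D))).compLinearMap (fun _ => mapColour F) =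
      multilinearExtension (L.link.eval (C := C)) := by
    refine Module.Basis.ext_multilinear (fun _ => Finsupp.basisSingleOne) fun v => ?_
    simp only [MultilinearMap.compLinearMap_apply, Finsupp.coe_basisSingleOne, mapColour_single,
      multilinearExtension_single]
    exact L.link.eval_map F hF v
  rw [← this, MultilinearMap.compLinearMap_apply]
  congr 1
  ext1 k
  rcases k with k | k <;> rfl

end LinkMultilinear

open PivotalCategory FusionCategory

/-! ### Multiplicities of simple objects -/

section Semisimple

lemma compositionMap_single {C : Type u₁} [Category.{v₁} C] [Preadditive C]
    [Linear ℂ C] {ι : Type} [Fintype ι] [DecidableEq ι] (Z : ι → C) (X Y : C) (i : ι)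
    (t : TensorProduct ℂ (X ⟶ Z i) (Z i ⟶ Y)) :
    compositionMap Z X Y (Pi.single i t) = TensorProduct.lift (Linear.comp X (Z i) Y) t := by
  rw [compositionMap, LinearMap.sum_apply, Finset.sum_eq_single i]
  · simp
  · intro j _ hj
    simp [hj]
  · simp

variable {C : Type u₁} [Category.{v₁} C] [Preadditive C] [Linear ℂ C] [MonoidalCategory C]
  [FusionCategory C]

/-- Schur's lemma for inequivalent simple objects. -/
lemma hom_irr_eq_zero {i j : Fin (numIrr C)} (hij : i ≠ j) (f : irr i ⟶ (irr j : C)) : f = 0 := by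
  -- The morphism `f` factors through `irr i` and through `irr j`. Uniqueness of the decomposition
  -- forces the two to agree, although they lie in different summands.
  have h : (Pi.single i (𝟙 _ ⊗ₜ[ℂ] f) : ∀ k, TensorProduct ℂ (irr i ⟶ (irr k : C)) (irr k ⟶ irr j)) =
      Pi.single j (f ⊗ₜ[ℂ] 𝟙 _) := by
    refine (irr_decompose (irr i : C) (irr j)).1 ?_
    rw [compositionMap_single, compositionMap_single]
    simp
  have h' := congrArg (TensorProduct.lift (Linear.comp (irr i) (irr i) (irr j : C))) (congrFun h i)
  simpa [hij] using h'

/-- A morphism space between an object and a simple object has dual bases. -/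
lemma exists_dual_bases (X : C) :
    ∃ (b : ∀ i : Fin (numIrr C), Fin (Module.finrank ℂ (irr i ⟶ X)) → (irr i ⟶ X))
      (g : ∀ i : Fin (numIrr C), Fin (Module.finrank ℂ (irr i ⟶ X)) → (X ⟶ irr i)),
      (∑ i, ∑ a, g i a ≫ b i a = 𝟙 X) ∧
      ∀ i a c, b i c ≫ g i a = if c = a then 𝟙 (irr i) else 0 := by
  have := finiteDimensional_hom (C := C)
  let b := fun i : Fin (numIrr C) => Module.finBasis ℂ (irr i ⟶ X)
  -- The dual family consists of the coefficients, in the basis `b`, of a decomposition of the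
  -- identity.
  obtain ⟨t, ht⟩ := (irr_decompose X X).2 (𝟙 X)
  choose g hg using fun i => TensorProduct.eq_repr_basis_right (b i) (t i)
  have hsum : ∑ i, ∑ a, g i a ≫ b i a = 𝟙 X := by
    rw [← ht, compositionMap, LinearMap.sum_apply]
    refine Finset.sum_congr rfl fun i _ => ?_
    rw [LinearMap.comp_apply, LinearMap.proj_apply, ← hg i, Finsupp.sum_fintype _ _ (by simp)]
    simp
  refine ⟨fun i => b i, fun i => g i, hsum, fun i a c => ?_⟩
  choose γ hγ using fun a => (irr_simple i).2 (b i c ≫ g i a)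
  -- Composing the decomposition of the identity with `b i c` leaves only the summands at `i`, by
  -- Schur's lemma. Comparing coordinates then determines `γ`.
  have h1 : ∑ a, γ a • b i a = b i c := by
    have := congrArg (b i c ≫ ·) hsum
    simp only [Preadditive.comp_sum, Category.comp_id] at this
    rw [Finset.sum_eq_single i] at this
    · rw [← this]
      refine Finset.sum_congr rfl fun a _ => ?_
      rw [← Category.assoc, ← hγ a]
      simp
    · intro j _ hj
      refine Finset.sum_eq_zero fun a _ => ?_
      rw [← Category.assoc, hom_irr_eq_zero hj.symm (b i c ≫ g j a), zero_comp]
    · simp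
  have h2 := congrArg (fun x => (b i).repr x a) h1
  simp only [map_sum, map_smul, Module.Basis.repr_self, Finsupp.coe_finsetSum, Finset.sum_apply,
    Finsupp.smul_apply, Finsupp.single_apply, smul_eq_mul] at h2
  have h3 : γ a = if c = a then 1 else 0 := by simpa using h2
  rw [← hγ a]
  simp [h3]

/-- The dual family is a basis of the opposite morphism space, with the same index set. -/
lemma finrank_hom_irr (X : C) (i : Fin (numIrr C)) :
    Module.finrank ℂ (X ⟶ irr i) = Module.finrank ℂ (irr i ⟶ X) := by
  obtain ⟨b, g, hsum, hbg⟩ := exists_dual_bases X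
  have hli : LinearIndependent ℂ (g i) := by
    rw [Fintype.linearIndependent_iff]
    intro c hc a
    have := congrArg (b i a ≫ ·) hc
    simp only [Preadditive.comp_sum, Linear.comp_smul, hbg, comp_zero] at this
    refine (irr_simple (C := C) i).1 ?_
    simpa using this
  have hsp : ⊤ ≤ Submodule.span ℂ (Set.range (g i)) := by
    intro h _
    have h1 : h = ∑ a, g i a ≫ b i a ≫ h := by
      have := congrArg (· ≫ h) hsum
      simp only [Preadditive.sum_comp, Category.id_comp, Category.assoc] at this
      rw [Finset.sum_eq_single i] at this
      · exact this.symm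
      · intro j _ hj
        refine Finset.sum_eq_zero fun a _ => ?_
        rw [hom_irr_eq_zero hj (b j a ≫ h), comp_zero]
      · simp
    rw [h1]
    refine Submodule.sum_mem _ fun a _ => ?_
    obtain ⟨c, hc⟩ := (irr_simple i).2 (b i a ≫ h)
    rw [← hc]
    simp only [Linear.comp_smul, Category.comp_id]
    exact Submodule.smul_mem _ _ (Submodule.subset_span ⟨a, rfl⟩)
  rw [Module.finrank_eq_card_basis (Module.Basis.mk hli hsp), Fintype.card_fin]

/-- Frobenius reciprocity for dimensions of morphism spaces. -/
lemma finrank_tensor_hom [LeftRigidCategory C] (X Y Z : C) :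
    Module.finrank ℂ (X ⊗ Y ⟶ Z) = Module.finrank ℂ (Y ⟶ dual X ⊗ Z) := by
  refine LinearEquiv.finrank_eq
    { tensorLeftHomEquiv Y (dual X) X Z with
      map_add' := fun f g => ?_
      map_smul' := fun c f => ?_ }
  · simp [tensorLeftHomEquiv]
  · simp [tensorLeftHomEquiv]

end Semisimple

/-! ### Dimension of the unit -/

section UnitDim

variable {C : Type u₁} [Category.{v₁} C] [MonoidalCategory C] [PivotalCategory C]

lemma coevTilde_unit : coevTilde (𝟙_ C) = (λ_ (𝟙_ C)).inv ≫ 𝟙_ C ◁ dualUnit C := by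
  have hp : coevTilde (𝟙_ C) ≫ (piv (𝟙_ C)).hom ▷ dual (𝟙_ C) = coev (dual (𝟙_ C)) := by
    simp [coevTilde, ← comp_whiskerRight]
  have hc : coev (𝟙_ C) = (λ_ (𝟙_ C)).inv ≫ dualUnit C ▷ 𝟙_ C := by
    rw [← coevaluation_toDual (𝟙_ C) (𝟙_ C), dualUnit_eq, unitors_inv_equal]
    rfl
  have := isIso_dualMap (dualUnit C)
  rw [← cancel_mono ((piv (𝟙_ C)).hom ▷ dual (𝟙_ C)), hp,
    ← cancel_mono (dualMap (dualUnit C) ▷ dual (𝟙_ C)), coev_dualMap, hc]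
  simp only [Category.assoc]
  rw [← comp_whiskerRight, piv_unit, whisker_exchange]

lemma trR_id_unit : trR (𝟙 (𝟙_ C)) = 𝟙 (𝟙_ C) := by
  rw [trR, id_whiskerRight, Category.id_comp, coevTilde_unit, Category.assoc, dualUnit,
    whiskerLeft_toDual_ev, Iso.inv_hom_id]

end UnitDim

/-! ### Reality of dimensions and the global dimension -/

section GlobalDim

variable {C : Type u₁} [Category.{v₁} C] [Preadditive C] [Linear ℂ C] [MonoidalCategory C]
  [SphericalFusionCategory C]

lemma dim_unit : dim (𝟙_ C) = 1 := by
  rw [dim, trR_id_unit, scalar_id]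

lemma dim_eq_sum (X : C) :
    dim X = ∑ i : Fin (numIrr C), (Module.finrank ℂ (irr i ⟶ X) : ℂ) * dim (irr i : C) := by
  obtain ⟨b, g, hsum, hbg⟩ := exists_dual_bases X
  let φ : (X ⟶ X) →+ ℂ := AddMonoidHom.mk' (fun f => scalar (trR f)) fun f g => by
    rw [trR_add, scalar_add]
  have h : dim X = φ (∑ i, ∑ a, g i a ≫ b i a) := by rw [hsum]; rfl
  rw [h, map_sum]
  refine Finset.sum_congr rfl fun i _ => ?_
  rw [map_sum]
  have key a : φ (g i a ≫ b i a) = dim (irr i : C) := by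
    change scalar (trR _) = _
    rw [trR_comp_comm, hbg, if_pos rfl, dim]
  simp [key]

/-- Otherwise all simple dimensions vanish, and so does the dimension of the unit, which is 1. -/
lemma sum_normSq_dim_pos : 0 < ∑ i : Fin (numIrr C), Complex.normSq (dim (irr i : C)) := by
  refine lt_of_le_of_ne (Finset.sum_nonneg fun i _ => Complex.normSq_nonneg _) fun h => ?_
  rw [eq_comm, Finset.sum_eq_zero_iff_of_nonneg fun i _ => Complex.normSq_nonneg _] at h
  have h1 := dim_eq_sum (𝟙_ C)
  rw [dim_unit, Finset.sum_eq_zero] at h1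
  · exact one_ne_zero h1
  · intro i hi
    rw [Complex.normSq_eq_zero.1 (h i hi), mul_zero]

/-- Dimensions in a spherical fusion category are real. -/
lemma conj_dim (X : C) : (starRingEnd ℂ) (dim X) = dim X := by
  let d : Fin (numIrr C) → ℂ := fun i => dim (irr i : C)
  -- The multiplicity matrix of tensoring with `X`. Duality transposes it (`hN`), and `d` is an
  -- eigenvector with eigenvalue `dim X` (`hd`).
  let N (X : C) (j k : Fin (numIrr C)) : ℕ := Module.finrank ℂ (irr k ⟶ X ⊗ irr j)
  have hN (j k) : N (dual X) j k = N X k j := by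
    simp only [N]
    rw [← finrank_tensor_hom, finrank_hom_irr]
  have hd (X : C) (j) : ∑ k, (N X j k : ℂ) * d k = dim X * d j := by
    rw [← dim_tensor, dim_eq_sum (X ⊗ irr j)]
  have hS : (∑ j, d j * (starRingEnd ℂ) (d j)) ≠ 0 := by
    simp only [Complex.mul_conj, d]
    rw [← Complex.ofReal_sum, Complex.ofReal_ne_zero]
    exact (sum_normSq_dim_pos (C := C)).ne'
  refine mul_right_cancel₀ hS ?_
  -- The usual argument for real eigenvalues: the matrix is moved from one side of the Hermitian
  -- form of `d` with itself to the other. Its entries are natural numbers, so conjugation fixes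
  -- them.
  calc
    _ = ∑ j, (starRingEnd ℂ) (dim (dual X) * d j) * d j := by
      rw [dim_dual, Finset.mul_sum]
      exact Finset.sum_congr rfl fun j _ => by rw [map_mul]; ring
    _ = ∑ j, ∑ k, (N X k j : ℂ) * (starRingEnd ℂ) (d k) * d j := by
      refine Finset.sum_congr rfl fun j _ => ?_
      rw [← hd, map_sum, Finset.sum_mul]
      simp [hN]
    _ = ∑ k, (dim X * d k) * (starRingEnd ℂ) (d k) := by
      rw [Finset.sum_comm]
      refine Finset.sum_congr rfl fun k _ => ?_
      rw [← hd, Finset.sum_mul]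
      exact Finset.sum_congr rfl fun j _ => by ring
    _ = _ := by
      rw [Finset.mul_sum]
      exact Finset.sum_congr rfl fun j _ => by ring

/-- The global dimension of a spherical fusion category does not vanish. -/
lemma colourDim_kirbyColour_ne_zero : colourDim (kirbyColour C) ≠ 0 := by
  have : colourDim (kirbyColour C) =
      ((∑ i : Fin (numIrr C), Complex.normSq (dim (irr i : C)) : ℝ) : ℂ) := by
    rw [colourDim_eq, kirbyColour, map_sum, Complex.ofReal_sum]
    refine Finset.sum_congr rfl fun i _ => ?_
    rw [Finsupp.linearCombination_single, smul_eq_mul, ← Complex.mul_conj, conj_dim]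
  rw [this, Complex.ofReal_ne_zero]
  exact (sum_normSq_dim_pos (C := C)).ne'

end GlobalDim

/-! ### Kirby colours under functors, and the theorem -/

lemma mapColour_comp {C : Type u₁} [Category.{v₁} C] {D : Type u₂} [Category.{v₂} D]
    {E : Type u₃} [Category.{v₃} E] (F : C ⥤ D) (G : D ⥤ E) (x : Colour C) :
    mapColour (F ⋙ G) x = mapColour G (mapColour F x) := by
  simp only [mapColour, Finsupp.lmapDomain_apply]
  exact Finsupp.mapDomain_comp (f := F.obj) (g := G.obj)

/-- A pivotal functor that preserves the Kirby colour up to a factor has a nonzero factor. -/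
lemma IsPivotal.kirbyColour_factor_ne_zero {C : Type u₁} [Category.{v₁} C] [Preadditive C]
    [Linear ℂ C] [MonoidalCategory C] [SphericalFusionCategory C] {D : Type u₂} [Category.{v₂} D]
    [Preadditive D] [Linear ℂ D] [MonoidalCategory D] [SphericalFusionCategory D] {F : C ⥤ D}
    [F.Additive] [F.Linear ℂ] [F.Monoidal] (hF : IsPivotal F) {n : ℂ}
    (h : toFusionAlgebra (mapColour F (kirbyColour C)) = n • toFusionAlgebra (kirbyColour D)) :
    colourDim (kirbyColour C) = n * colourDim (kirbyColour D) ∧ n ≠ 0 := by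
  rw [← map_smul] at h
  have h' := colourDim_eq_of_toFusionAlgebra_eq h
  rw [hF.colourDim_mapColour, colourDim_smul] at h'
  refine ⟨h', ?_⟩
  rintro rfl
  exact colourDim_kirbyColour_ne_zero (C := C) (by rw [h', zero_mul])

end Dichromatic

theorem mainTheorem7
    {A : Type u₁} [Category.{v₁} A] [Preadditive A] [Linear ℂ A] [MonoidalCategory A]
    [SphericalFusionCategory A]
    {B : Type u₂} [Category.{v₂} B] [Preadditive B] [Linear ℂ B] [MonoidalCategory B]
    [SphericalFusionCategory B]
    {C : Type u₃} [Category.{v₃} C] [Preadditive C] [Linear ℂ C] [MonoidalCategory C]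
    [RibbonFusionCategory C]
    {D : Type u₄} [Category.{v₄} D] [Preadditive D] [Linear ℂ D] [MonoidalCategory D]
    [RibbonFusionCategory D]
    (F : A ⥤ B) [F.Additive] [F.Linear ℂ] [F.Monoidal] (hF : IsPivotal F)
    (G : B ⥤ C) [G.Additive] [G.Linear ℂ] [G.Monoidal] (hG : IsPivotal G)
    (H : C ⥤ D) [H.Additive] [H.Linear ℂ] [H.Braided] (hH : IsPivotal H)
    (hH_twist : PreservesTwist H)
    (hC : TrivialTwistOnCentre C) (hD : TrivialTwistOnCentre D)
    (n m : ℂ)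
    (hFΩ : toFusionAlgebra (mapColour F (kirbyColour A)) =
      n • toFusionAlgebra (kirbyColour B))
    (hHΩ : toFusionAlgebra (mapColour H (kirbyColour C)) =
      m • toFusionAlgebra (kirbyColour D))
    (hHG : toFusionAlgebra (mapColour H (transparentPart (mapColour G (kirbyColour B)))) =
      toFusionAlgebra (transparentPart (mapColour (G ⋙ H) (kirbyColour B)))) :
    ∀ L : DottedLinkDiagram,
      dichromaticInvariant (F ⋙ G ⋙ H) L = dichromaticInvariant G L := by
  intro L
  obtain ⟨hA, hn⟩ := hF.kirbyColour_factor_ne_zero hFΩ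
  obtain ⟨hC', hm⟩ := hH.kirbyColour_factor_ne_zero hHΩ
  have hΩD : toFusionAlgebra (kirbyColour D) =
      m⁻¹ • toFusionAlgebra (mapColour H (kirbyColour C)) := by
    rw [hHΩ, inv_smul_smul₀ hm]
  have hdD : colourDim (kirbyColour D) = m⁻¹ * colourDim (kirbyColour C) := by
    rw [hC', inv_mul_cancel_left₀ hm]
  have hFGH : toFusionAlgebra (mapColour (F ⋙ G ⋙ H) (kirbyColour A)) =
      toFusionAlgebra (n • mapColour (G ⋙ H) (kirbyColour B)) := by
    rw [← map_smul] at hFΩ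
    rw [mapColour_comp, toFusionAlgebra_mapColour_eq (G ⋙ H) hFΩ, map_smul (mapColour (G ⋙ H))]
  have hnum : L.eval (kirbyColour D) (mapColour (F ⋙ G ⋙ H) (kirbyColour A)) =
      m⁻¹ ^ L.h₁ * n ^ L.h₂ * L.eval (kirbyColour C) (mapColour G (kirbyColour B)) := by
    rw [L.eval_of_smul hΩD (hFGH.trans (map_smul _ _ _)), mapColour_comp,
      L.eval_mapColour H hH]
  have htr : colourDim (transparentPart (mapColour (F ⋙ G ⋙ H) (kirbyColour A))) =
      n * colourDim (transparentPart (mapColour G (kirbyColour B))) := by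
    rw [transparentPart_eq_of_toFusionAlgebra_eq hFGH, transparentPart_smul, colourDim_smul,
      ← colourDim_eq_of_toFusionAlgebra_eq hHG, hH.colourDim_mapColour]
  -- The exponent `h₂ - h₁` from the global dimension and `h₁` from the transparent part add up to
  -- `n ^ h₂`. The difference may be negative, so `n ≠ 0` is needed.
  have hden : ∀ x y t : ℂ,
      (n * x) ^ ((L.h₂ : ℤ) - (L.h₁ : ℤ)) * (m⁻¹ * y * (n * t)) ^ L.h₁ =
        m⁻¹ ^ L.h₁ * n ^ L.h₂ * (x ^ ((L.h₂ : ℤ) - (L.h₁ : ℤ)) * (y * t) ^ L.h₁) := by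
    intro x y t
    have hpow : n ^ ((L.h₂ : ℤ) - (L.h₁ : ℤ)) * n ^ L.h₁ = n ^ L.h₂ := by
      rw [← zpow_natCast, ← zpow_natCast, ← zpow_add₀ hn, sub_add_cancel]
    rw [mul_zpow, ← hpow]
    ring
  -- Only the common factor has to be nonzero; the remaining denominator is the same on both sides
  -- and may vanish.
  rw [dichromaticInvariant, dichromaticInvariant, hnum, hA, hdD, htr, hden,
    mul_div_mul_left _ _ (mul_ne_zero (pow_ne_zero _ (inv_ne_zero hm)) (pow_ne_zero _ hn))]
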